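/- Let $n\ge 2$, let $K$ be a field of characteristic $0$ and let $q^{1/4}\in K$ be nonzero and not a root of unity (for instance $K=\mathbb C(q^{1/4})$). Put $[x]=\frac{q^x-q^{-x}}{q-q^{-1}}$. Let $\varepsilon_1,\dots,\varepsilon_n$ be a basis of $P=\bigoplus_i\mathbb Z\varepsilon_i$ with $(\varepsilon_i|\varepsilon_j)=\frac12\delta_{ij}$, let $\alpha_i=\varepsilon_i-\varepsilon_{i+1}$ $(i<n)$, $\alpha_n=2\varepsilon_n$, $\lambda_1=\varepsilon_1$, $\lambda_n=\varepsilon_1+\dots+\varepsilon_n$. Let $a_i(m),b_i(m)$ $(1\le i\le n,\ m\in\mathbb Z)$ be Heisenberg operators with $$[a_i(m),a_j(l)]=\delta_{m+l,0}\frac{[m(\alpha_i|\alpha_j)]\,[-\tfrac m2]}{m},\qquad [b_i(m),b_j(l)]=m\,\delta_{ij}\delta_{m+l,0},\qquad [a_i(m),b_j(l)]=0$$ (the first commutator being $0$ for $m=0$), acting on $\widetilde{\mathcal F}=\bigoplus_{\alpha\in P+\frac12\mathbb Z\lambda_n,\ \beta\in P}\mathcal F_{\alpha,\beta}$, where $\mathcal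 F_{\alpha,\beta}$ is the Fock space freely generated by the $a_i(-m),b_i(-m)$, $m>0$, from a vacuum vector $|\alpha,\beta\rangle$ that is killed by $a_i(m),b_i(m)$, $m>0$, and on which $a_i(0)=(\alpha_i|\alpha)$, $b_i(0)=(2\varepsilon_i|\beta)$. Let $\lambda_1(0)$ act on $\mathcal F_{\alpha,\beta}$ as $(2\lambda_1|\alpha)$, and let $e^{\gamma}$ $(\gamma\in P)$ and $e^{\pm b_i}$ commute with all oscillators $a_j(m),b_j(m)$, $m\neq0$, and map $|\alpha,\beta\rangle$ to $|\alpha+\gamma,\beta\rangle$ and $|\alpha,\beta\pm\varepsilon_i\rangle$. Put $$Y_i^{\pm}(z)=\exp\Big(\pm\sum_{k\ge1}\frac{a_i(-k)}{[-k/2]}q^{\pm k/4}z^k\Big)\exp\Big(\mp\sum_{k\ge1}\frac{a_i(k)}{[-k/2]}q^{\pm k/4}z^{-k}\Big)e^{\pm\alpha_i}z^{\mp2a_i(0)},$$ $$Z_i^{\pm}(z)=\exp\Big(\pm\sum_{k\ge1}\frac{b_i(-k)}{k}z^k\Big)\exp\Big(\mp\sum_{k\ge1}\frac{b_i(k)}{k}z^{-k}\Big)e^{\pm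 b_i}z^{\pm b_i(0)},$$ $\partial f(z)=\frac{f(q^{1/2}z)-f(q^{-1/2}z)}{(q^{1/2}-q^{-1/2})z}$, and $X_1^-(z)=Z_1^-(z)\,\partial Z_2^+(z)\,Y_1^-(z)=\sum_{m\in\mathbb Z}x_1^-(m)z^{-m-1}$. Let $f_1=x_1^-(0)$, the action of the Chevalley generator $f_1$ of $U_q(C_n^{(1)})$ on $\widetilde{\mathcal F}$. For $k\ne0$ let $a_{\bar1}(k)$ be the linear combination of $a_1(k),\dots,a_n(k)$ determined by $[a_j(k),a_{\bar1}(l)]=\delta_{j1}\delta_{k,-l}$, that is, $$a_{\bar1}(k)=\frac{k}{[k/2]^2\,C_{n+1}(k)}\Big(\sum_{i=1}^{n-1}C_{n+1-i}(k)\,a_i(k)+a_n(k)\Big),\qquad C_m(k)=q^{mk/2}+q^{-mk/2}.$$ For $c\in K$ and $\kappa\in\mathbb Q$ let $$\Phi_{\bar1}(z)=c\,\exp\Big(\sum_{k\ge1}\frac{[k/2]}{k}q^{(n+\frac14)k}a_{\bar1}(-k)z^k\Big)\exp\Big(\sum_{k\ge1}\frac{[k/2]}{k}q^{-(n+\frac34)k}a_{\bar1}(k)z^{-k}\Big)e^{\lambda_1}\,(q^{n+\frac12}z)^{-\lambda_1(0)}\,z^{\kappa}\,(\partial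 Z_1^+)(q^{n+\frac12}z),$$ a formal series in rational powers of $z$ with coefficients in $\operatorname{End}(\widetilde{\mathcal F})$; $c$ and $\kappa$ are arbitrary normalizations. Then, coefficient by coefficient in $z$, on $\widetilde{\mathcal F}$, $$\Phi_{\bar1}(z)\,f_1^2-(q^{1/2}+q^{-1/2})\,f_1\,\Phi_{\bar1}(z)\,f_1+f_1^2\,\Phi_{\bar1}(z)=0 .$$ -/

import Mathlib

/-!
# The bosonic Fock space of `U_q(C_n^{(1)})` at level `-1/2`

Throughout, `s` stands for `q^{1/4}`, so `q^{m/4} = s ^ m`.  The indices `1, …, n` of the text are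
the elements `0, …, n - 1` of `Fin n`.
-/

open scoped BigOperators

noncomputable section

namespace SpBoson

/-! ## `q`-numbers, lattice -/

/-- The `q`-number `[m/2] = (q^{m/2} - q^{-m/2}) / (q - q^{-1})`, as a function of `m`. -/
def qHalf {K : Type*} [Field K] (s : K) (m : ℤ) : K :=
  (s ^ (2 * m) - s ^ (-(2 * m))) / (s ^ (4 : ℤ) - s ^ (-4 : ℤ))

/-- `ε_i`, in the coordinates given by `ε_1, …, ε_n`. -/
def eps {n : ℕ} (i : Fin n) : Fin n → ℤ := Pi.single i 1

/-- The simple root `α_i = ε_i - ε_{i+1}` for `i < n`, and `α_n = 2 ε_n`. -/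
def root {n : ℕ} (i : Fin n) : Fin n → ℤ :=
  if h : i.val + 1 < n then eps i - eps ⟨i.val + 1, h⟩ else 2 • eps i

/-- The sum `∑ x_j y_j`, so that the inner product is `(x|y) = (1/2) ∑ x_j y_j`,
because `(ε_i|ε_j) = δ_{ij}/2`. -/
def dot {n : ℕ} (x y : Fin n → ℤ) : ℤ := ∑ j, x j * y j

/-- The lattice `P + (1/2) ℤ λ_n`, where `λ_n = ε_1 + ⋯ + ε_n`.  The tuple `d` stands for
`α = (1/2) ∑ d_j ε_j`; the condition says that all the `d_j` have the same parity. -/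
def HalfLattice (n : ℕ) : AddSubgroup (Fin n → ℤ) where
  carrier := {d | ∀ i j, Even (d i - d j)}
  zero_mem' := fun i j => by simp
  add_mem' := fun {x y} hx hy i j => by
    have h := (hx i j).add (hy i j)
    have e : (x + y) i - (x + y) j = x i - x j + (y i - y j) := by
      simp only [Pi.add_apply]; ring
    rw [e]; exact h
  neg_mem' := fun {x} hx i j => by
    have h := (hx i j).neg
    have e : (-x) i - (-x) j = -(x i - x j) := by
      simp only [Pi.neg_apply]; ring
    rw [e]; exact h

/-- A vector of `P`, as an element of `P + (1/2) ℤ λ_n`. -/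
def ofP {n : ℕ} (x : Fin n → ℤ) : HalfLattice n :=
  ⟨2 • x, fun i j => ⟨x i - x j, by simp only [Pi.smul_apply, nsmul_eq_mul]; push_cast; ring⟩⟩

/-! ## The Fock space and the Heisenberg operators -/

/-- The labels `(α, β)` of the vacuum vectors `|α, β⟩`, with `α ∈ P + (1/2) ℤ λ_n`, `β ∈ P`. -/
abbrev Sector (n : ℕ) : Type := HalfLattice n × (Fin n → ℤ)

/-- The creation operators: `Sum.inl (i, k)` is `a_i(-(k+1))`, `Sum.inr (i, k)` is
`b_i(-(k+1))`. -/
abbrev OscVar (n : ℕ) : Type := (Fin n × ℕ) ⊕ (Fin n × ℕ)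

/-- A single Fock space: polynomials in the creation operators, applied to the vacuum. -/
abbrev Osc (K : Type*) [Field K] (n : ℕ) : Type _ := MvPolynomial (OscVar n) K

/-- The total Fock space, the direct sum of the `F_{α, β}`. -/
abbrev Fock (K : Type*) [Field K] (n : ℕ) : Type _ := Sector n →₀ Osc K n

/-- The operator acting on the summand `F_l` as `T l`. -/
def onSectors {K : Type*} [Field K] {n : ℕ} (T : Sector n → Module.End K (Osc K n)) :
    Module.End K (Fock K n) :=
  Finsupp.lsum K fun l => (Finsupp.lsingle l).comp (T l)

/-- `[m (α_i|α_j)] [-m/2] / m`, the value of the commutator `[a_i(m), a_j(-m)]`. -/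
def aComm {K : Type*} [Field K] (s : K) {n : ℕ} (i j : Fin n) (m : ℤ) : K :=
  qHalf s (m * dot (root i) (root j)) * qHalf s (-m) / (m : K)

/-- The operators `a_i(m)`: multiplication by the variable for `m < 0`, the scalar `(α_i|α)` on
`F_{α, β}` for `m = 0`, and for `m > 0` the derivation that kills the vacuum and has the
prescribed commutators with the `a_j(-m)`. -/
def aMode {K : Type*} [Field K] (s : K) {n : ℕ} (i : Fin n) : ℤ → Module.End K (Fock K n)
  | Int.ofNat 0 => onSectors fun l => ((dot (root i) l.1.1 : ℤ) / 4 : K) • LinearMap.id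
  | Int.ofNat (k + 1) => onSectors fun _ =>
      ∑ j, aComm s i j ((k : ℤ) + 1) • (MvPolynomial.pderiv (Sum.inl (j, k))).toLinearMap
  | Int.negSucc k => onSectors fun _ => LinearMap.mulLeft K (MvPolynomial.X (Sum.inl (i, k)))

/-- The operators `b_i(m)`, with `[b_i(m), b_j(l)] = m δ_{ij} δ_{m+l,0}` and
`b_i(0) = (2 ε_i|β)` on `F_{α, β}`. -/
def bMode {K : Type*} [Field K] {n : ℕ} (i : Fin n) : ℤ → Module.End K (Fock K n)
  | Int.ofNat 0 => onSectors fun l => ((dot (eps i) l.2 : ℤ) : K) • LinearMap.id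
  | Int.ofNat (k + 1) => onSectors fun _ =>
      ((k : K) + 1) • (MvPolynomial.pderiv (Sum.inr (i, k))).toLinearMap
  | Int.negSucc k => onSectors fun _ => LinearMap.mulLeft K (MvPolynomial.X (Sum.inr (i, k)))

/-! ## Vertex operators -/

/-- The exponential `∑_j f^j / j!` of a power series `f` without constant term.  Since `f^j` is
divisible by `t^j`, only `j ≤ m` contribute to the coefficient of `t^m`. -/
def expSeries (K : Type*) {A : Type*} [Field K] [Ring A] [Algebra K A] (f : PowerSeries A) :
    PowerSeries A :=
  PowerSeries.mk fun m =>
    ∑ j ∈ Finset.range (m + 1), ((j.factorial : K)⁻¹) • PowerSeries.coeff m (f ^ j)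

/-- The data of the normally ordered vertex operator

`exp (∑_{k ≥ 1} ∑_i (aCre i k a_i(-k) + bCre i k b_i(-k)) z^k)`
`· exp (∑_{k ≥ 1} ∑_i (aAnn i k a_i(k) + bAnn i k b_i(k)) z^{-k}) · e^{shift} · scal · z^{expo}`,

where `scal` and `expo` are functions of the zero modes, that is of the label `(α, β)` of the
summand `F_{α, β}` to which the operator is applied. -/
structure VertexData (K : Type*) [Field K] (n : ℕ) where
  aCre : Fin n → ℕ → K
  bCre : Fin n → ℕ → K
  aAnn : Fin n → ℕ → K
  bAnn : Fin n → ℕ → K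
  shift : Sector n
  scal : Sector n → K
  expo : Sector n → ℚ

namespace VertexData

/-- The normally ordered product `:V(z) W(z):`.  If `V` and `W` are made of bosons that commute
with one another, then this is the product `V(z) W(z)`. -/
def normalProd {K : Type*} [Field K] {n : ℕ} (V W : VertexData K n) : VertexData K n where
  aCre := V.aCre + W.aCre
  bCre := V.bCre + W.bCre
  aAnn := V.aAnn + W.aAnn
  bAnn := V.bAnn + W.bAnn
  shift := V.shift + W.shift
  scal := V.scal * W.scal
  expo := V.expo + W.expo

/-- The exponent `∑_{k ≥ 1} ∑_i (aCre i k a_i(-k) + bCre i k b_i(-k)) t^k`, with `t = z`. -/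
def creExponent {K : Type*} [Field K] {n : ℕ} (s : K) (V : VertexData K n) :
    PowerSeries (Module.End K (Fock K n)) :=
  PowerSeries.mk fun k => if k = 0 then 0 else
    ∑ i, (V.aCre i k • aMode s i (-(k : ℤ)) + V.bCre i k • bMode i (-(k : ℤ)))

/-- The exponent `∑_{k ≥ 1} ∑_i (aAnn i k a_i(k) + bAnn i k b_i(k)) t^k`, with `t = z^{-1}`. -/
def annExponent {K : Type*} [Field K] {n : ℕ} (s : K) (V : VertexData K n) :
    PowerSeries (Module.End K (Fock K n)) :=
  PowerSeries.mk fun k => if k = 0 then 0 else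
    ∑ i, (V.aAnn i k • aMode s i (k : ℤ) + V.bAnn i k • bMode i (k : ℤ))

/-- The coefficient of `z^i` in the creation part. -/
def cre {K : Type*} [Field K] {n : ℕ} (s : K) (V : VertexData K n) (i : ℕ) :
    Module.End K (Fock K n) :=
  PowerSeries.coeff i (expSeries K (V.creExponent s))

/-- The coefficient of `z^{-j}` in the annihilation part. -/
def ann {K : Type*} [Field K] {n : ℕ} (s : K) (V : VertexData K n) (j : ℕ) :
    Module.End K (Fock K n) :=
  PowerSeries.coeff j (expSeries K (V.annExponent s))

/-- The coefficient of `z^t` in the zero mode part `e^{shift} · scal · z^{expo}`. -/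
def zeroPart {K : Type*} [Field K] {n : ℕ} (V : VertexData K n) (t : ℚ) :
    Module.End K (Fock K n) :=
  Finsupp.lsum K fun l =>
    if V.expo l = t then V.scal l • Finsupp.lsingle (l + V.shift) else 0

end VertexData

/-! ### Local finiteness: on each vector, only finitely many terms contribute to a mode -/

/-- The level of a monomial, `a_i(-k)` and `b_i(-k)` having level `k`. -/
def varLevel {n : ℕ} : OscVar n → ℕ
  | Sum.inl p => p.2 + 1
  | Sum.inr p => p.2 + 1

/-- The span of the monomials of level at most `N`. -/
def levelLE (K : Type*) [Field K] (n : ℕ) (N : ℤ) : Submodule K (Osc K n) :=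
  Submodule.span K {p | ∃ d : OscVar n →₀ ℕ,
    ((Finsupp.weight varLevel d : ℕ) : ℤ) ≤ N ∧ p = MvPolynomial.monomial d 1}

/-- The vectors of the Fock space all of whose components have level at most `N`. -/
def fockLE (K : Type*) [Field K] (n : ℕ) (N : ℤ) : Submodule K (Fock K n) where
  carrier := {v | ∀ l, v l ∈ levelLE K n N}
  zero_mem' := fun l => by simp
  add_mem' := fun {v w} hv hw l => by
    rw [Finsupp.add_apply]; exact Submodule.add_mem _ (hv l) (hw l)
  smul_mem' := fun c v hv l => by
    rw [Finsupp.smul_apply]; exact Submodule.smul_mem _ c (hv l)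

theorem levelLE_mono {K : Type*} [Field K] {n : ℕ} {M N : ℤ} (h : M ≤ N) :
    levelLE K n M ≤ levelLE K n N :=
  Submodule.span_mono fun _ ⟨d, hd, hp⟩ => ⟨d, hd.trans h, hp⟩

theorem fockLE_neg {K : Type*} [Field K] {n : ℕ} {N : ℤ} (h : N < 0) {v : Fock K n}
    (hv : v ∈ fockLE K n N) : v = 0 := by
  ext1 l
  have hl : v l ∈ levelLE K n N := hv l
  have he : levelLE K n N = ⊥ := by
    rw [levelLE, Submodule.span_eq_bot]
    rintro p ⟨d, hd, -⟩
    exfalso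
    have : (0 : ℤ) ≤ ((Finsupp.weight varLevel d : ℕ) : ℤ) := Int.natCast_nonneg _
    linarith
  rw [he, Submodule.mem_bot] at hl
  simpa using hl

theorem exists_levelLE {K : Type*} [Field K] {n : ℕ} (p : Osc K n) :
    ∃ N : ℤ, p ∈ levelLE K n N := by
  induction p using MvPolynomial.induction_on'' with
  | C a =>
    refine ⟨0, ?_⟩
    have : (MvPolynomial.C a : Osc K n) = a • MvPolynomial.monomial 0 1 := by
      rw [MvPolynomial.smul_monomial]; simp
    rw [this]
    exact Submodule.smul_mem _ _ (Submodule.subset_span ⟨0, by simp, rfl⟩)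
  | monomial_add d b f _ _ hf hm =>
    obtain ⟨M, hM⟩ := hf
    obtain ⟨N, hN⟩ := hm
    exact ⟨max M N, Submodule.add_mem _ (levelLE_mono (le_max_right _ _) hN)
      (levelLE_mono (le_max_left _ _) hM)⟩
  | mul_X p x hp =>
    obtain ⟨N, hN⟩ := hp
    refine ⟨N + varLevel x, ?_⟩
    rw [levelLE] at hN
    induction hN using Submodule.span_induction with
    | mem y hy =>
      obtain ⟨d, hd, rfl⟩ := hy
      refine Submodule.subset_span ⟨d + Finsupp.single x 1, ?_, ?_⟩
      · rw [map_add, Finsupp.weight_single]; push_cast; simp; linarith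
      · rw [MvPolynomial.X, MvPolynomial.monomial_mul, one_mul]
    | zero => simp
    | add y z _ _ hy hz => rw [add_mul]; exact Submodule.add_mem _ hy hz
    | smul c y _ hy => rw [smul_mul_assoc]; exact Submodule.smul_mem _ _ hy

theorem exists_fockLE {K : Type*} [Field K] {n : ℕ} (v : Fock K n) :
    ∃ N : ℤ, v ∈ fockLE K n N := by
  induction v using Finsupp.induction_linear with
  | zero => exact ⟨0, Submodule.zero_mem _⟩
  | add v w hv hw =>
    obtain ⟨M, hM⟩ := hv
    obtain ⟨N, hN⟩ := hw
    exact ⟨max M N, Submodule.add_mem _ (fun l => levelLE_mono (le_max_left _ _) (hM l))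
      (fun l => levelLE_mono (le_max_right _ _) (hN l))⟩
  | single l p =>
    obtain ⟨N, hN⟩ := exists_levelLE p
    refine ⟨N, fun l' => ?_⟩
    classical
    rw [Finsupp.single_apply]
    split_ifs
    · exact hN
    · exact Submodule.zero_mem _

theorem pderiv_levelLE {K : Type*} [Field K] {n : ℕ} {N : ℤ} (x : OscVar n) {p : Osc K n}
    (hp : p ∈ levelLE K n N) : MvPolynomial.pderiv x p ∈ levelLE K n (N - varLevel x) := by
  rw [levelLE] at hp
  induction hp using Submodule.span_induction with
  | mem y hy =>
    obtain ⟨d, hd, rfl⟩ := hy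
    rw [MvPolynomial.pderiv_monomial]
    by_cases h0 : d x = 0
    · simp [h0]
    · have he : d - Finsupp.single x 1 + Finsupp.single x 1 = d := by
        refine tsub_add_cancel_of_le ?_
        rw [Finsupp.single_le_iff]; omega
      have hw := congrArg (Finsupp.weight (varLevel (n := n))) he
      rw [map_add, Finsupp.weight_single] at hw
      have : (MvPolynomial.monomial (d - Finsupp.single x 1) (1 * ((d x : ℕ) : K)) : Osc K n)
          = ((d x : ℕ) : K) • MvPolynomial.monomial (d - Finsupp.single x 1) 1 := by
        rw [MvPolynomial.smul_monomial]; simp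
      rw [this]
      refine Submodule.smul_mem _ _ (Submodule.subset_span ⟨_, ?_, rfl⟩)
      have hw' : (Finsupp.weight varLevel (d - Finsupp.single x 1) : ℕ) + varLevel x
          = Finsupp.weight varLevel d := by simpa using hw
      omega
  | zero => simp
  | add y z _ _ hy hz => rw [map_add]; exact Submodule.add_mem _ hy hz
  | smul c y _ hy => rw [Derivation.map_smul]; exact Submodule.smul_mem _ _ hy

theorem onSectors_apply {K : Type*} [Field K] {n : ℕ} (T : Sector n → Module.End K (Osc K n))
    (v : Fock K n) (l : Sector n) : onSectors T v l = T l (v l) := by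
  induction v using Finsupp.induction_linear with
  | zero => simp
  | add v w hv hw => simp [hv, hw]
  | single l' p =>
    classical
    simp only [onSectors, Finsupp.lsum_single, LinearMap.comp_apply, Finsupp.lsingle_apply,
      Finsupp.single_apply]
    split_ifs with h
    · rw [h]
    · simp

theorem aMode_fockLE {K : Type*} [Field K] (s : K) {n : ℕ} (i : Fin n) {k : ℕ} (hk : k ≠ 0)
    {N : ℤ} {v : Fock K n} (hv : v ∈ fockLE K n N) :
    aMode s i (k : ℤ) v ∈ fockLE K n (N - k) := by
  obtain ⟨m, rfl⟩ := Nat.exists_eq_succ_of_ne_zero hk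
  intro l
  have : aMode s i ((m.succ : ℕ) : ℤ) = onSectors fun _ =>
      ∑ j, aComm s i j ((m : ℤ) + 1) • (MvPolynomial.pderiv (Sum.inl (j, m))).toLinearMap := rfl
  rw [this, onSectors_apply, LinearMap.sum_apply]
  refine Submodule.sum_mem _ fun j _ => ?_
  rw [LinearMap.smul_apply]
  exact Submodule.smul_mem _ _ (pderiv_levelLE (Sum.inl (j, m)) (hv l))

theorem bMode_fockLE {K : Type*} [Field K] {n : ℕ} (i : Fin n) {k : ℕ} (hk : k ≠ 0)
    {N : ℤ} {v : Fock K n} (hv : v ∈ fockLE K n N) :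
    bMode i (k : ℤ) v ∈ fockLE K n (N - k) := by
  obtain ⟨m, rfl⟩ := Nat.exists_eq_succ_of_ne_zero hk
  intro l
  have : bMode (K := K) i ((m.succ : ℕ) : ℤ) = onSectors fun _ =>
      ((m : K) + 1) • (MvPolynomial.pderiv (Sum.inr (i, m))).toLinearMap := rfl
  rw [this, onSectors_apply, LinearMap.smul_apply]
  exact Submodule.smul_mem _ _ (pderiv_levelLE (Sum.inr (i, m)) (hv l))

namespace VertexData

theorem annExponent_fockLE {K : Type*} [Field K] {n : ℕ} (s : K) (V : VertexData K n) (k : ℕ)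
    {N : ℤ} {v : Fock K n} (hv : v ∈ fockLE K n N) :
    PowerSeries.coeff k (V.annExponent s) v ∈ fockLE K n (N - k) := by
  rw [annExponent, PowerSeries.coeff_mk]
  split_ifs with hk
  · simp
  · rw [LinearMap.sum_apply]
    refine Submodule.sum_mem _ fun i _ => ?_
    rw [LinearMap.add_apply, LinearMap.smul_apply, LinearMap.smul_apply]
    exact Submodule.add_mem _ (Submodule.smul_mem _ _ (aMode_fockLE s i hk hv))
      (Submodule.smul_mem _ _ (bMode_fockLE i hk hv))

theorem annExponent_pow_fockLE {K : Type*} [Field K] {n : ℕ} (s : K) (V : VertexData K n)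
    (m : ℕ) : ∀ (k : ℕ) {N : ℤ} {v : Fock K n}, v ∈ fockLE K n N →
    PowerSeries.coeff k (V.annExponent s ^ m) v ∈ fockLE K n (N - k) := by
  induction m with
  | zero =>
    intro k N v hv
    rw [pow_zero, PowerSeries.coeff_one]
    split_ifs with hk
    · subst hk; simpa using hv
    · simp
  | succ m ih =>
    intro k N v hv
    rw [pow_succ, PowerSeries.coeff_mul, LinearMap.sum_apply]
    refine Submodule.sum_mem _ fun p hp => ?_
    have h := ih p.1 (annExponent_fockLE s V p.2 hv)
    have e : N - (p.2 : ℤ) - (p.1 : ℤ) = N - (k : ℤ) := by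
      have := Finset.HasAntidiagonal.mem_antidiagonal.mp hp
      omega
    rw [e] at h
    exact h

theorem ann_fockLE {K : Type*} [Field K] {n : ℕ} (s : K) (V : VertexData K n) (j : ℕ)
    {N : ℤ} {v : Fock K n} (hv : v ∈ fockLE K n N) : V.ann s j v ∈ fockLE K n (N - j) := by
  rw [ann, expSeries, PowerSeries.coeff_mk, LinearMap.sum_apply]
  refine Submodule.sum_mem _ fun m _ => ?_
  rw [LinearMap.smul_apply]
  exact Submodule.smul_mem _ _ (annExponent_pow_fockLE s V m j hv)

theorem zeroPart_fockLE {K : Type*} [Field K] {n : ℕ} (V : VertexData K n) (t : ℚ)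
    {N : ℤ} {v : Fock K n} (hv : v ∈ fockLE K n N) : V.zeroPart t v ∈ fockLE K n N := by
  classical
  rw [zeroPart, Finsupp.lsum_apply, Finsupp.sum]
  refine Submodule.sum_mem _ fun l _ => ?_
  split_ifs
  · rw [LinearMap.smul_apply]
    refine Submodule.smul_mem _ _ fun l' => ?_
    rw [Finsupp.lsingle_apply, Finsupp.single_apply]
    split_ifs
    · exact hv l
    · exact Submodule.zero_mem _
  · simp

theorem zeroPart_eq_zero {K : Type*} [Field K] {n : ℕ} (V : VertexData K n) (t : ℚ)
    (v : Fock K n) (h : ∀ l ∈ v.support, V.expo l ≠ t) : V.zeroPart t v = 0 := by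
  rw [zeroPart, Finsupp.lsum_apply, Finsupp.sum]
  refine Finset.sum_eq_zero fun l hl => ?_
  rw [if_neg (h l hl), LinearMap.zero_apply]

/-- The terms of the coefficient of `z^r` applied to `v`. -/
def term {K : Type*} [Field K] {n : ℕ} (s : K) (V : VertexData K n) (r : ℚ) (v : Fock K n)
    (p : ℕ × ℕ) : Fock K n :=
  V.cre s p.1 (V.ann s p.2 (V.zeroPart (r - p.1 + p.2) v))

theorem finite_support_term {K : Type*} [Field K] {n : ℕ} (s : K) (V : VertexData K n) (r : ℚ)
    (v : Fock K n) : (Function.support (V.term s r v)).Finite := by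
  obtain ⟨N, hN⟩ := exists_fockLE v
  have hfin : (⋃ l ∈ v.support, ⋃ j ∈ Finset.range (N.toNat + 1),
      {p : ℕ × ℕ | p.2 = j ∧ (p.1 : ℚ) = r + j - V.expo l}).Finite := by
    refine Set.Finite.biUnion (Finset.finite_toSet _) fun l _ =>
      Set.Finite.biUnion (Finset.finite_toSet _) fun j _ => ?_
    refine Set.Subsingleton.finite ?_
    rintro ⟨a, b⟩ ⟨h1, h2⟩ ⟨a', b'⟩ ⟨h3, h4⟩
    simp only at h1 h2 h3 h4
    rw [← h4] at h2
    rw [Prod.mk.injEq]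
    exact ⟨by exact_mod_cast h2, h1.trans h3.symm⟩
  refine hfin.subset fun p hp => ?_
  by_contra hcon
  apply hp
  by_cases hz : ∀ l ∈ v.support, V.expo l ≠ r - p.1 + p.2
  · rw [term, zeroPart_eq_zero V _ v hz, map_zero, map_zero]
  · push Not at hz
    obtain ⟨l, hl, he⟩ := hz
    have hj : N - (p.2 : ℤ) < 0 := by
      by_contra hj
      apply hcon
      simp only [Set.mem_iUnion]
      exact ⟨l, hl, p.2, by rw [Finset.mem_range]; omega, rfl, by rw [he]; ring⟩
    rw [term, fockLE_neg hj (ann_fockLE s V p.2 (zeroPart_fockLE V _ hN)), map_zero]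

/-- The coefficient of `z^r` in the vertex operator with data `V`, as an endomorphism of the Fock
space: the sum of all products of the coefficient of `z^i` in the creation part, of `z^{-j}` in
the annihilation part and of `z^{r - i + j}` in the zero mode part. -/
def mode {K : Type*} [Field K] {n : ℕ} (s : K) (V : VertexData K n) (r : ℚ) :
    Module.End K (Fock K n) where
  toFun v := ∑ᶠ p : ℕ × ℕ, V.term s r v p
  map_add' v w := by
    rw [← finsum_add_distrib (finite_support_term s V r v) (finite_support_term s V r w)]
    simp only [term, map_add]
  map_smul' c v := by
    rw [RingHom.id_apply, smul_finsum' c (finite_support_term s V r v)]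
    simp only [term, map_smul]

end VertexData

/-! ## The currents and the vertex operator -/

/-- `Y_i^±(z) = exp (± ∑ a_i(-k)/[-k/2] q^{±k/4} z^k) exp (∓ ∑ a_i(k)/[-k/2] q^{±k/4} z^{-k})
e^{±α_i} z^{∓2 a_i(0)}`, the sign being `σ = ±1`. -/
def Y {K : Type*} [Field K] (s : K) {n : ℕ} (σ : ℤ) (i : Fin n) : VertexData K n where
  aCre := Pi.single i fun k => σ * s ^ (σ * k) / qHalf s (-(k : ℤ))
  bCre := 0
  aAnn := Pi.single i fun k => -(σ * s ^ (σ * k) / qHalf s (-(k : ℤ)))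
  bAnn := 0
  shift := (ofP (σ • root i), 0)
  scal := 1
  expo := fun l => -(σ : ℚ) * (2 * ((dot (root i) l.1.1 : ℤ) / 4 : ℚ))

/-- `Z_i^±(tz)`, where `Z_i^±(z) = exp (± ∑ b_i(-k)/k z^k) exp (∓ ∑ b_i(k)/k z^{-k})
e^{±b_i} z^{±b_i(0)}`, the sign being `σ = ±1`. -/
def Z {K : Type*} [Field K] {n : ℕ} (σ : ℤ) (i : Fin n) (t : K) : VertexData K n where
  aCre := 0
  bCre := Pi.single i fun k => σ / k * t ^ k
  aAnn := 0
  bAnn := Pi.single i fun k => -(σ / k * (t ^ k)⁻¹)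
  shift := (0, σ • eps i)
  scal := fun l => t ^ (σ * dot (eps i) l.2)
  expo := fun l => σ * (dot (eps i) l.2 : ℤ)

/-- `X_{iε}^-(z) = Z_i^-(z) Z_{i+1}^+(q^{ε/2} z) Y_i^-(z)`, for `i < n` (in the numbering from
`1`); the three factors commute. -/
def XMinusPart {K : Type*} [Field K] (s : K) {n : ℕ} (i : ℕ) (hi : i + 1 < n) (ε : ℤ) :
    VertexData K n :=
  ((Z (-1) ⟨i, by omega⟩ 1).normalProd (Z 1 ⟨i + 1, hi⟩ (s ^ (2 * ε)))).normalProd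
    (Y s (-1) ⟨i, by omega⟩)

/-- The mode `x_i^-(m)`, the coefficient of `z^{-m-1}` in
`X_i^-(z) = Z_i^-(z) ∂Z_{i+1}^+(z) Y_i^-(z)
  = (X_{i+}^-(z) - X_{i-}^-(z)) / ((q^{1/2} - q^{-1/2}) z)`. -/
def xMinus {K : Type*} [Field K] (s : K) {n : ℕ} (i : ℕ) (hi : i + 1 < n) (m : ℤ) :
    Module.End K (Fock K n) :=
  (s ^ 2 - s ^ (-2 : ℤ))⁻¹ •
    ((XMinusPart s i hi 1).mode s (-(m : ℚ)) - (XMinusPart s i hi (-1)).mode s (-(m : ℚ)))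

/-- The action of the Chevalley generator `f_1`, which is `x_1^-(0)`. -/
def f₁ {K : Type*} [Field K] (s : K) {n : ℕ} (hn : 2 ≤ n) : Module.End K (Fock K n) :=
  xMinus s 0 (by omega) 0

/-- The coefficient of `a_i(k)` in the element `a_{\bar 1}(k)`, `k ≠ 0`, of the Heisenberg algebra
that is determined by `[a_j(k), a_{\bar 1}(l)] = δ_{j1} δ_{k,-l}`.  It is `k / [k/2]^2` times
`(q^{(n+1-i)k/2} + q^{-(n+1-i)k/2}) / (q^{(n+1)k/2} + q^{-(n+1)k/2})` for `i < n` and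
times `1 / (q^{(n+1)k/2} + q^{-(n+1)k/2})` for `i = n` (in the numbering from `1`). -/
def aBarCoeff {K : Type*} [Field K] (s : K) {n : ℕ} (i : Fin n) (k : ℤ) : K :=
  k / qHalf s k ^ 2 *
    ((if i.val + 1 < n then s ^ (2 * (n - i.val) * k) + s ^ (-(2 * (n - i.val) * k)) else 1) /
      (s ^ (2 * (n + 1) * k) + s ^ (-(2 * (n + 1) * k))))

/-- The factor
`exp (∑ [k/2]/k q^{(n+1/4)k} a_{\bar 1}(-k) z^k) exp (∑ [k/2]/k q^{-(n+3/4)k} a_{\bar 1}(k) z^{-k})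
· c · e^{λ_1} (q^{n+1/2})^{-λ_1(0)} z^{-λ_1(0) + κ}`
of `Φ_{\bar 1}(z)`; here `λ_1(0)` acts on `F_{α, β}` as `(2 λ_1|α)`. -/
def PhiA {K : Type*} [Field K] (s : K) {n : ℕ} (hn : 2 ≤ n) (c : K) (κ : ℚ) :
    VertexData K n where
  aCre := fun i k => qHalf s k / k * s ^ ((4 * n + 1) * k) * aBarCoeff s i (-(k : ℤ))
  bCre := 0
  aAnn := fun i k => qHalf s k / k * (s ^ ((4 * n + 3) * k))⁻¹ * aBarCoeff s i k
  bAnn := 0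
  shift := (ofP (eps ⟨0, by omega⟩), 0)
  scal := fun l => c * s ^ (-((2 * n + 1) * dot (eps ⟨0, by omega⟩) l.1.1))
  expo := fun l => -((dot (eps ⟨0, by omega⟩) l.1.1 : ℤ) / 2 : ℚ) + κ

/-- `Φ_{\bar 1 ε}(z)`, obtained from `Φ_{\bar 1}(z)` by replacing `∂Z_1^+(q^{n+1/2} z)` by
`Z_1^+(q^{n+1/2+ε/2} z)`; the two factors commute. -/
def PhiPart {K : Type*} [Field K] (s : K) {n : ℕ} (hn : 2 ≤ n) (c : K) (κ : ℚ) (ε : ℤ) :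
    VertexData K n :=
  (PhiA s hn c κ).normalProd (Z 1 ⟨0, by omega⟩ (s ^ (4 * n + 2 + 2 * ε)))

/-- The coefficient of `z^r` in `Φ_{\bar 1}(z)`, where, with `u = q^{n+1/2} z`,
`∂Z_1^+(u) = (Z_1^+(q^{1/2} u) - Z_1^+(q^{-1/2} u)) / ((q^{1/2} - q^{-1/2}) u)`. -/
def PhiBar {K : Type*} [Field K] (s : K) {n : ℕ} (hn : 2 ≤ n) (c : K) (κ : ℚ) (r : ℚ) :
    Module.End K (Fock K n) :=
  ((s ^ 2 - s ^ (-2 : ℤ)) * s ^ (4 * n + 2))⁻¹ •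
    ((PhiPart s hn c κ 1).mode s (r + 1) - (PhiPart s hn c κ (-1)).mode s (r + 1))

end SpBoson

end

/-! Write a = q^{1/2}. Expanding the two q-derivatives splits X_1^- into X_+ − X_- and Φ into Φ_+ −
Φ_-, up to a scalar and a power of the variable, and every piece is an honest normally ordered
exponential. The Serre expression is linear in Φ and quadratic in the current. It therefore suffices
that Φ X Y − (a + a⁻¹) X Φ Y + X Y Φ, symmetrized in the currents X = X_ε and Y = X_ε', vanishes for
each Φ_δ. This is proved for all modes at once, because the argument relates different modes to each
other.

The operator product expansions provide the exchange relations. With w₁, w₂ the variables of X, Y,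
the currents satisfy (w₁ − a⁻² w₂) X Y = (a⁻² w₁ − w₂) Y X. With z the variable of Φ and b a
suitable power of q, (1 − ab z/w) X(w) Φ_+(z) = (a − b z/w) Φ_+(z) X(w). For Φ_- a relation of the
same shape holds with the order of the factors and the variables reversed. Multiplying the Serre
expression by (1 − ab z/w₁)(1 − ab z/w₂) moves Φ to the left of every term; what remains is a
multiple of z Φ (a/w₂ − a⁻¹/w₁) X Y, and its symmetrization is zero by the exchange of X and Y
(`serre_exchange`, `symSerre_exchange`).

Cancelling the two factors is not automatic, since two-sided series such as delta functions can be
annihilated by them. What saves the argument is that one of the two orders of Φ and X has no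
contraction. For Φ_+ the annihilation part of Φ commutes with X and Y, so on a fixed vector the
power of z is bounded below in all terms. For Φ_- the annihilation parts of the currents commute
with the creation part of Φ, so the total power of w₁ and w₂ is bounded below. In both cases the
factors act injectively (`eq_zero_of_shift_eq`), which gives `symSerre_mode_eq_zero` and
`symSerre_mode_eq_zero'`. -/

noncomputable section

namespace SpBoson

/-! ## Exponentials of power series with noncommuting coefficients -/

section Exponential

variable {K R : Type*} [Field K] [Ring R] [Algebra K R]

/-- The Euler operator `t d/dt`. -/
def euler (f : PowerSeries R) : PowerSeries R := PowerSeries.mk fun m => m • PowerSeries.coeff m f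

theorem coeff_euler (m : ℕ) (f : PowerSeries R) :
    PowerSeries.coeff m (euler f) = m • PowerSeries.coeff m f := PowerSeries.coeff_mk _ _

theorem euler_mul (f g : PowerSeries R) : euler (f * g) = euler f * g + f * euler g := by
  ext m
  simp only [coeff_euler, map_add, PowerSeries.coeff_mul, Finset.smul_sum,
    ← Finset.sum_add_distrib]
  refine Finset.sum_congr rfl fun p hp => ?_
  rw [← Finset.HasAntidiagonal.mem_antidiagonal.mp hp, add_smul, smul_mul_assoc, mul_smul_comm]

theorem coeff_pow_eq_zero {f : PowerSeries R} (hf : PowerSeries.coeff 0 f = 0) :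
    ∀ {j m : ℕ}, m < j → PowerSeries.coeff m (f ^ j) = 0 := by
  intro j
  induction j with
  | zero => intro m h; omega
  | succ j ih =>
    intro m h
    rw [pow_succ', PowerSeries.coeff_mul]
    refine Finset.sum_eq_zero fun p hp => ?_
    have hp' := Finset.HasAntidiagonal.mem_antidiagonal.mp hp
    rcases Nat.eq_zero_or_pos p.1 with h0 | h0
    · rw [h0, hf, zero_mul]
    · rw [ih (by omega), mul_zero]

theorem coeff_expSeries {f : PowerSeries R} (hf : PowerSeries.coeff 0 f = 0) {m B : ℕ}
    (h : m < B) : PowerSeries.coeff m (expSeries K f) =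
      ∑ j ∈ Finset.range B, ((j.factorial : K)⁻¹) • PowerSeries.coeff m (f ^ j) := by
  rw [expSeries, PowerSeries.coeff_mk]
  refine Finset.sum_subset (Finset.range_subset_range.mpr h) fun j _ hj => ?_
  rw [coeff_pow_eq_zero hf (by simpa using hj), smul_zero]

theorem coeff_zero_expSeries (f : PowerSeries R) :
    PowerSeries.coeff 0 (expSeries K f) = 1 := by
  simp [expSeries]

/-- If `δ` acts on the powers of `f` like a derivation with `δ f = u`, then `δ (exp f) = u exp f`.
Here `δ` is given by additive maps on the coefficients. -/
theorem coeff_derivation_expSeries [CharZero K] {f : PowerSeries R} (hf : PowerSeries.coeff 0 f = 0)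
    (u : PowerSeries R) (m : ℕ) (d : R →ₗ[K] R)
    (hd : ∀ j : ℕ, d (PowerSeries.coeff m (f ^ j)) = j • PowerSeries.coeff m (u * f ^ (j - 1))) :
    d (PowerSeries.coeff m (expSeries K f)) = PowerSeries.coeff m (u * expSeries K f) := by
  -- Cutting at `m + 2` leaves, once the term `j = 0` is split off and `j` is lowered by one, the
  -- range `m + 1`, which is long enough for every coefficient of order at most `m` on the right.
  rw [coeff_expSeries hf (show m < m + 2 by omega), map_sum, Finset.sum_range_succ']
  have h0 : d (((Nat.factorial 0 : K)⁻¹) • PowerSeries.coeff m (f ^ 0)) = 0 := by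
    rw [map_smul, hd 0, zero_smul, smul_zero]
  have h1 : ∀ p ∈ Finset.HasAntidiagonal.antidiagonal m,
      PowerSeries.coeff p.1 u * PowerSeries.coeff p.2 (expSeries K f) =
      ∑ j ∈ Finset.range (m + 1), ((j.factorial : K)⁻¹) •
        (PowerSeries.coeff p.1 u * PowerSeries.coeff p.2 (f ^ j)) := fun p hp => by
    have hp' := Finset.HasAntidiagonal.mem_antidiagonal.mp hp
    rw [coeff_expSeries hf (show p.2 < m + 1 by omega), Finset.mul_sum]
    simp only [mul_smul_comm]
  rw [h0, add_zero, PowerSeries.coeff_mul, Finset.sum_congr rfl h1, Finset.sum_comm]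
  refine Finset.sum_congr rfl fun j _ => ?_
  rw [map_smul, hd, ← Finset.smul_sum, ← PowerSeries.coeff_mul, Nat.add_sub_cancel,
    Nat.factorial_succ, ← Nat.cast_smul_eq_nsmul K, smul_smul]
  congr 1
  have h1 : ((j : K) + 1) ≠ 0 := by exact_mod_cast Nat.succ_ne_zero j
  have h2 : (j.factorial : K) ≠ 0 := by exact_mod_cast Nat.factorial_ne_zero j
  push_cast
  field_simp

theorem commute_of_coeff {f g : PowerSeries R}
    (h : ∀ k l, Commute (PowerSeries.coeff k f) (PowerSeries.coeff l g)) : Commute f g := by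
  refine PowerSeries.ext fun m => ?_
  rw [PowerSeries.coeff_mul, PowerSeries.coeff_mul, ← Finset.Nat.sum_antidiagonal_swap]
  exact Finset.sum_congr rfl fun p _ => (h p.2 p.1).eq

theorem commute_coeff_pow {x : R} {f : PowerSeries R}
    (h : ∀ k, Commute x (PowerSeries.coeff k f)) (j m : ℕ) :
    Commute x (PowerSeries.coeff m (f ^ j)) := by
  have hc : Commute (PowerSeries.C x) (f ^ j) := by
    refine Commute.pow_right (commute_of_coeff fun k l => ?_) j
    rw [PowerSeries.coeff_C]
    split_ifs
    · exact h l
    · exact Commute.zero_left _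
  have := congrArg (PowerSeries.coeff m) hc.eq
  rwa [PowerSeries.coeff_C_mul, PowerSeries.coeff_mul_C] at this

theorem commute_coeff_expSeries {x : R} {f : PowerSeries R}
    (h : ∀ k, Commute x (PowerSeries.coeff k f)) (m : ℕ) :
    Commute x (PowerSeries.coeff m (expSeries K f)) := by
  rw [expSeries, PowerSeries.coeff_mk]
  exact Commute.sum_right _ _ _ fun j _ => (commute_coeff_pow h j m).smul_right _

/-- Since the coefficients of `f` commute, `f` commutes with its Euler derivative, so the power rule
holds as in the commutative case. -/
theorem euler_expSeries [CharZero K] {f : PowerSeries R} (hf : PowerSeries.coeff 0 f = 0)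
    (hc : ∀ k l, Commute (PowerSeries.coeff k f) (PowerSeries.coeff l f)) :
    euler (expSeries K f) = euler f * expSeries K f := by
  have hcomm : Commute f (euler f) := commute_of_coeff fun k l => by
    rw [coeff_euler]; exact (hc k l).smul_right _
  have hpow : ∀ j : ℕ, euler (f ^ j) = j • (euler f * f ^ (j - 1)) := by
    intro j
    induction j with
    | zero =>
      ext m
      rw [coeff_euler, pow_zero, PowerSeries.coeff_one, zero_smul, map_zero]
      split_ifs with h <;> simp [h]
    | succ j ih =>
      rw [pow_succ, euler_mul, ih, Nat.add_sub_cancel, (hcomm.symm.pow_right j).eq, succ_nsmul,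
        smul_mul_assoc, mul_assoc]
      rcases j with _ | j
      · simp
      · rw [Nat.add_sub_cancel, ← pow_succ, (hcomm.symm.pow_right (j + 1)).eq]
  ext m
  rw [coeff_euler]
  refine coeff_derivation_expSeries hf (euler f) m (m • LinearMap.id) fun j => ?_
  rw [LinearMap.smul_apply, LinearMap.id_apply, ← coeff_euler, hpow, map_nsmul]

/-- If the coefficients of `f` have the commutators `[x, f_l] = δ_{kl} c`, then
`[x, exp f] = c t^k exp f`. -/
theorem commutator_coeff_expSeries [CharZero K] {f : PowerSeries R} (hf : PowerSeries.coeff 0 f = 0) {x : R}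
    {k : ℕ} {c : K}
    (hx : ∀ l, x * PowerSeries.coeff l f - PowerSeries.coeff l f * x =
      if l = k then algebraMap K R c else 0) (m : ℕ) :
    x * PowerSeries.coeff m (expSeries K f) - PowerSeries.coeff m (expSeries K f) * x =
      c • (if k ≤ m then PowerSeries.coeff (m - k) (expSeries K f) else 0) := by
  set u : PowerSeries R := PowerSeries.C (algebraMap K R c) * PowerSeries.X ^ k with hu
  have h1 : PowerSeries.C x * f - f * PowerSeries.C x = u := by
    ext l
    rw [map_sub, PowerSeries.coeff_C_mul, PowerSeries.coeff_mul_C, hx, hu,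
      PowerSeries.coeff_C_mul_X_pow]
  have hcu : ∀ g : PowerSeries R, Commute u g := fun g => by
    refine Commute.mul_left (commute_of_coeff fun a b => ?_) (PowerSeries.commute_X_pow g k).symm
    rw [PowerSeries.coeff_C]
    split_ifs
    · exact Algebra.commutes c _
    · exact Commute.zero_left _
  have hpow : ∀ j : ℕ, PowerSeries.C x * f ^ j - f ^ j * PowerSeries.C x =
      j • (u * f ^ (j - 1)) := by
    intro j
    induction j with
    | zero => simp
    | succ j ih =>
      have e : PowerSeries.C x * f ^ (j + 1) - f ^ (j + 1) * PowerSeries.C x =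
          (PowerSeries.C x * f ^ j - f ^ j * PowerSeries.C x) * f +
            f ^ j * (PowerSeries.C x * f - f * PowerSeries.C x) := by
        rw [pow_succ]; noncomm_ring
      rw [e, ih, h1, Nat.add_sub_cancel, ← (hcu (f ^ j)).eq, succ_nsmul, smul_mul_assoc,
        mul_assoc]
      rcases j with _ | j
      · simp
      · rw [Nat.add_sub_cancel, ← pow_succ]
  have h := coeff_derivation_expSeries (K := K) hf u m
    (LinearMap.mulLeft K x - LinearMap.mulRight K x) fun j => by
      rw [← map_nsmul, ← hpow, map_sub, PowerSeries.coeff_C_mul, PowerSeries.coeff_mul_C]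
      rfl
  rw [LinearMap.sub_apply, LinearMap.mulLeft_apply, LinearMap.mulRight_apply] at h
  rw [h, hu, mul_assoc, PowerSeries.coeff_C_mul, PowerSeries.coeff_X_pow_mul', Algebra.smul_def]

/-- Uniqueness for a linear differential equation: as `D` has no constant term, m times the
coefficient of t^m is determined by lower coefficients, and m is invertible in characteristic 0. -/
theorem eq_of_euler_eq (K : Type*) [Field K] [CharZero K] [Algebra K R] {D L L' : PowerSeries R} (hD : PowerSeries.coeff 0 D = 0)
    (hL : euler L = D * L) (hL' : euler L' = D * L')
    (h0 : PowerSeries.coeff 0 L = PowerSeries.coeff 0 L') : L = L' := by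
  ext m
  induction m using Nat.strong_induction_on with
  | _ m ih =>
    rcases Nat.eq_zero_or_pos m with rfl | hm
    · exact h0
    have h : m • PowerSeries.coeff m L = m • PowerSeries.coeff m L' := by
      rw [← coeff_euler, ← coeff_euler, hL, hL', PowerSeries.coeff_mul, PowerSeries.coeff_mul]
      refine Finset.sum_congr rfl fun p hp => ?_
      have hp' := Finset.HasAntidiagonal.mem_antidiagonal.mp hp
      rcases Nat.eq_zero_or_pos p.1 with h1 | h1
      · rw [h1, hD, zero_mul, zero_mul]
      · rw [ih p.2 (by omega)]
    rw [← Nat.cast_smul_eq_nsmul K, ← Nat.cast_smul_eq_nsmul K] at h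
    exact smul_right_injective R (show (m : K) ≠ 0 by exact_mod_cast hm.ne') h

/-- The coefficients of `(1 - α t) / (1 - β t)`. -/
def geomRatio (α β : K) : ℕ → K
  | 0 => 1
  | m + 1 => β ^ m * (β - α)

/-- The logarithmic Euler derivative of (1 − αt)/(1 − βt) is ∑ (β^k − α^k) t^k; the sum collapses by
the geometric series. -/
theorem geomRatio_euler (α β : K) (m : ℕ) :
    ∑ p ∈ Finset.HasAntidiagonal.antidiagonal m, (β ^ p.1 - α ^ p.1) * geomRatio α β p.2 =
      m * geomRatio α β m := by
  rcases m with _ | m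
  · simp
  rw [Finset.Nat.sum_antidiagonal_succ']
  have h : ∀ p ∈ Finset.HasAntidiagonal.antidiagonal m, (β ^ p.1 - α ^ p.1) * geomRatio α β (p.2 + 1) =
      (β - α) * β ^ m - (β - α) * (α ^ p.1 * β ^ p.2) := fun p hp => by
    rw [← Finset.HasAntidiagonal.mem_antidiagonal.mp hp, geomRatio, pow_add]; ring
  rw [Finset.sum_congr rfl h, Finset.sum_sub_distrib, Finset.sum_const, ← Finset.mul_sum,
    Finset.Nat.card_antidiagonal,
    Finset.Nat.sum_antidiagonal_eq_sum_range_succ (fun i j => α ^ i * β ^ j)]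
  have hg := geom_sum₂_mul α β (m + 1)
  simp only [Nat.add_sub_cancel] at hg
  simp only [geomRatio, nsmul_eq_mul]
  push_cast
  linear_combination hg

/-- If `[D_k, C_q] = c_k C_{q-k}` with `k c_k = β^k - α^k`, then
`(1 - β t) A(t) C(w) = (1 - α t) C(w) A(t)` for `A(t) = exp D(t)`, where `t` lowers the index
of `C`. -/
theorem expSeries_mul_of_commutator [CharZero K] {D : PowerSeries R} (hD : PowerSeries.coeff 0 D = 0)
    (hc : ∀ k l, Commute (PowerSeries.coeff k D) (PowerSeries.coeff l D)) {C : ℚ → R} {c : ℕ → K}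
    (hDC : ∀ k q, PowerSeries.coeff k D * C q - C q * PowerSeries.coeff k D = c k • C (q - k))
    {α β : K} (hαβ : ∀ k : ℕ, k * c k = β ^ k - α ^ k) (q : ℚ) :
    expSeries K D * PowerSeries.C (C q) -
        β • (PowerSeries.X * (expSeries K D * PowerSeries.C (C (q - 1)))) =
      PowerSeries.C (C q) * expSeries K D -
        α • (PowerSeries.X * (PowerSeries.C (C (q - 1)) * expSeries K D)) := by
  set A := expSeries K D
  -- `G q` is the candidate for A C_q A⁻¹: the series (1 − αt)/(1 − βt) with t acting on the family
  -- `C` as the index shift.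
  set G : ℚ → PowerSeries R := fun q => PowerSeries.mk fun k => geomRatio α β k • C (q - k) with hG
  have hA : euler A = euler D * A := euler_expSeries hD hc
  have hGe : ∀ q, euler D * G q - G q * euler D = euler (G q) := fun q => by
    ext m
    have h : PowerSeries.coeff m (G q * euler D) = ∑ p ∈ Finset.HasAntidiagonal.antidiagonal m,
        PowerSeries.coeff p.2 (G q) * PowerSeries.coeff p.1 (euler D) := by
      rw [PowerSeries.coeff_mul, ← Finset.Nat.sum_antidiagonal_swap]; rfl
    rw [map_sub, h, PowerSeries.coeff_mul, ← Finset.sum_sub_distrib, coeff_euler, hG,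
      PowerSeries.coeff_mk, ← Nat.cast_smul_eq_nsmul K, smul_smul, ← geomRatio_euler,
      Finset.sum_smul]
    refine Finset.sum_congr rfl fun p hp => ?_
    rw [← Finset.HasAntidiagonal.mem_antidiagonal.mp hp, coeff_euler, PowerSeries.coeff_mk,
      ← Nat.cast_smul_eq_nsmul K, smul_mul_smul_comm, smul_mul_smul_comm,
      mul_comm (geomRatio α β p.2), ← smul_sub, hDC, smul_smul, ← hαβ]
    congr 1
    · ring
    · congr 1
      push_cast
      ring
  -- Both sides solve euler L = (euler D) L with the same constant term; for the right side this is
  -- `hGe`.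
  have hconj : ∀ q, A * PowerSeries.C (C q) = G q * A := fun q => by
    refine eq_of_euler_eq K (D := euler D) ?_ ?_ ?_ ?_
    · rw [coeff_euler, zero_smul]
    · have : euler (PowerSeries.C (C q)) = 0 := by
        ext m
        rw [coeff_euler, PowerSeries.coeff_C, map_zero]
        split_ifs with h <;> simp [h]
      rw [euler_mul, this, mul_zero, add_zero, hA, mul_assoc]
    · rw [euler_mul, hA, ← hGe]; noncomm_ring
    · rw [PowerSeries.coeff_mul_C]
      simp [A, coeff_zero_expSeries, hG, PowerSeries.coeff_mul, geomRatio]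
  have hrel : G q - β • (PowerSeries.X * G (q - 1)) =
      PowerSeries.C (C q) - α • (PowerSeries.X * PowerSeries.C (C (q - 1))) := by
    ext m
    rcases m with _ | m
    · simp [hG, geomRatio]
    · simp only [map_sub, PowerSeries.coeff_smul, PowerSeries.coeff_succ_X_mul, hG,
        PowerSeries.coeff_mk, PowerSeries.coeff_C, Nat.succ_ne_zero, if_false]
      have e : q - ((m + 1 : ℕ) : ℚ) = q - 1 - m := by push_cast; ring
      rw [e, smul_smul, ← sub_smul]
      rcases m with _ | m
      · simp [geomRatio]
      · simp [geomRatio, pow_succ']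
        ring_nf
        simp
  rw [hconj, hconj]
  have := congrArg (· * A) hrel
  simpa only [sub_mul, smul_mul_assoc, mul_assoc] using this

end Exponential

/-! ## Vertex operators on a single Fock space -/

section Exponential

variable {K R R' : Type*} [Field K] [Ring R] [Algebra K R] [Ring R'] [Algebra K R']

theorem map_coeff_expSeries (φ : R →ₐ[K] R') {f : PowerSeries R} {g : PowerSeries R'}
    (h : ∀ k, φ (PowerSeries.coeff k f) = PowerSeries.coeff k g) (m : ℕ) :
    φ (PowerSeries.coeff m (expSeries K f)) = PowerSeries.coeff m (expSeries K g) := by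
  have hg : g = PowerSeries.map (φ : R →+* R') f := PowerSeries.ext fun k => (h k).symm
  simp only [hg, expSeries, PowerSeries.coeff_mk, map_sum, map_smul, ← map_pow,
    PowerSeries.coeff_map]
  rfl

/-! ### Sequences extended by zero to rational indices, as the zero modes shift mode indices by
rational numbers -/

/-- A sequence, extended by zero to a function on the rational numbers. -/
def extendZero (f : ℕ → R) (q : ℚ) : R := if q.den = 1 ∧ 0 ≤ q.num then f q.num.toNat else 0

theorem extendZero_natCast (f : ℕ → R) (i : ℕ) : extendZero f i = f i := by
  simp [extendZero]

theorem extendZero_eq_zero (f : ℕ → R) {q : ℚ} (h : ∀ i : ℕ, (i : ℚ) ≠ q) :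
    extendZero f q = 0 := by
  rw [extendZero, if_neg]
  rintro ⟨h1, h2⟩
  refine h q.num.toNat ?_
  have : ((q.num.toNat : ℤ) : ℚ) = (q.num : ℚ) := by rw [Int.toNat_of_nonneg h2]
  rw [Int.cast_natCast] at this
  rw [this, Rat.coe_int_num_of_den_eq_one h1]

theorem extendZero_of_neg (f : ℕ → R) {q : ℚ} (h : q < 0) : extendZero f q = 0 :=
  extendZero_eq_zero f fun i hi => by
    have : (0 : ℚ) ≤ i := Nat.cast_nonneg i
    linarith

theorem extendZero_natCast_sub (f : ℕ → R) (i k : ℕ) :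
    extendZero f ((i : ℚ) - k) = if k ≤ i then f (i - k) else 0 := by
  split_ifs with h
  · rw [← Nat.cast_sub h, extendZero_natCast]
  · refine extendZero_of_neg f ?_
    have : (i : ℚ) < k := by exact_mod_cast not_le.mp h
    linarith

/-- The weak form of the commutation relation of `exp D(z^{-1})` and `exp E(w)`, on the level of
coefficients. -/
theorem extendZero_expSeries_exchange [CharZero K] {D E : PowerSeries R}
    (hD : PowerSeries.coeff 0 D = 0) (hE : PowerSeries.coeff 0 E = 0)
    (hc : ∀ k l, Commute (PowerSeries.coeff k D) (PowerSeries.coeff l D)) {c : ℕ → K}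
    (hDE : ∀ k l, PowerSeries.coeff k D * PowerSeries.coeff l E -
      PowerSeries.coeff l E * PowerSeries.coeff k D = if l = k then algebraMap K R (c k) else 0)
    {α β : K} (hαβ : ∀ k : ℕ, k * c k = β ^ k - α ^ k) (t q : ℚ) :
    let A := extendZero fun j => PowerSeries.coeff j (expSeries K D)
    let C := extendZero fun j => PowerSeries.coeff j (expSeries K E)
    A t * C q - β • (A (t - 1) * C (q - 1)) = C q * A t - α • (C (q - 1) * A (t - 1)) := by
  intro A C
  -- If `t` is not a natural number then neither is `t - 1`, and every term vanishes.
  by_cases ht : ∃ j : ℕ, (j : ℚ) = t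
  swap
  · push Not at ht
    have h1 : A t = 0 := extendZero_eq_zero _ ht
    have h2 : A (t - 1) = 0 := extendZero_eq_zero _ fun i hi => ht (i + 1) (by push_cast; linarith)
    simp [h1, h2]
  obtain ⟨j, rfl⟩ := ht
  have hDC : ∀ k q, PowerSeries.coeff k D * C q - C q * PowerSeries.coeff k D =
      c k • C (q - k) := fun k q => by
    by_cases hq : ∃ i : ℕ, (i : ℚ) = q
    · obtain ⟨i, rfl⟩ := hq
      have := commutator_coeff_expSeries hE (hDE k) i
      simp only [C, extendZero_natCast, extendZero_natCast_sub]
      exact this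
    · push Not at hq
      have h1 : C q = 0 := extendZero_eq_zero _ hq
      have h2 : C (q - k) = 0 :=
        extendZero_eq_zero _ fun i hi => hq (i + k) (by push_cast; linarith)
      simp [h1, h2]
  have h := congrArg (PowerSeries.coeff j) (expSeries_mul_of_commutator hD hc hDC hαβ q)
  simp only [map_sub, PowerSeries.coeff_smul, PowerSeries.coeff_mul_C,
    PowerSeries.coeff_C_mul] at h
  have hA : A j = PowerSeries.coeff j (expSeries K D) := extendZero_natCast _ j
  rcases j with _ | j
  · have h2 : A (((0 : ℕ) : ℚ) - 1) = 0 := extendZero_of_neg _ (by norm_num)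
    rw [h2, hA]
    simpa using h
  · have h2 : A (((j + 1 : ℕ) : ℚ) - 1) = PowerSeries.coeff j (expSeries K D) := by
      rw [← extendZero_natCast (fun j => PowerSeries.coeff j (expSeries K D))]
      simp [A]
    rw [h2, hA]
    simpa [PowerSeries.coeff_succ_X_mul] using h

theorem commute_extendZero {f g : ℕ → R} (h : ∀ i j, Commute (f i) (g j)) (p q : ℚ) :
    Commute (extendZero f p) (extendZero g q) := by
  unfold extendZero
  split_ifs
  · exact h _ _
  · exact Commute.zero_right _
  · exact Commute.zero_left _
  · exact Commute.zero_left _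

end Exponential

variable {K : Type*} [Field K] {n : ℕ}

/-- The operator that acts in the same way on all the summands. -/
def constSectors : Module.End K (Osc K n) →ₐ[K] Module.End K (Fock K n) :=
  AlgHom.ofLinearMap
    { toFun := fun T => onSectors fun _ => T
      map_add' := fun S T => by
        refine LinearMap.ext fun v => Finsupp.ext fun l => ?_
        simp [onSectors_apply]
      map_smul' := fun c T => by
        refine LinearMap.ext fun v => Finsupp.ext fun l => ?_
        simp [onSectors_apply] }
    (by
        refine LinearMap.ext fun v => Finsupp.ext fun l => ?_
        simp [onSectors_apply])
    (fun S T => by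
        refine LinearMap.ext fun v => Finsupp.ext fun l => ?_
        simp [onSectors_apply])

theorem constSectors_single (T : Module.End K (Osc K n)) (l : Sector n) (p : Osc K n) :
    constSectors T (Finsupp.single l p) = Finsupp.single l (T p) := by
  change onSectors (fun _ => T) (Finsupp.single l p) = _
  simp [onSectors]

theorem derivation_sum_apply {A ι : Type*} [CommRing A] [Algebra K A] (S : Finset ι)
    (D : ι → Derivation K A A) (p : A) : (∑ i ∈ S, D i) p = ∑ i ∈ S, D i p := by
  rw [← Derivation.coeFnAddMonoidHom_apply, map_sum, Finset.sum_apply]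
  rfl

/-- The derivation `a_i(k+1)` of a single Fock space. -/
def aDer (s : K) (i : Fin n) (k : ℕ) : Derivation K (Osc K n) (Osc K n) :=
  ∑ j, aComm s i j ((k : ℤ) + 1) • MvPolynomial.pderiv (Sum.inl (j, k))

namespace VertexData

/-! ### Creation exponents as multiplications, annihilation exponents as derivations -/

/-- The coefficient of `z^{k+1}` in the creation exponent, as an element of the Fock space. -/
def crePoly (V : VertexData K n) (k : ℕ) : Osc K n :=
  ∑ i, (V.aCre i (k + 1) • MvPolynomial.X (Sum.inl (i, k)) +
    V.bCre i (k + 1) • MvPolynomial.X (Sum.inr (i, k)))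

/-- The coefficient of `z^{-k-1}` in the annihilation exponent, as a derivation. -/
def annDer (s : K) (V : VertexData K n) (k : ℕ) : Derivation K (Osc K n) (Osc K n) :=
  ∑ i, (V.aAnn i (k + 1) • aDer s i k +
    V.bAnn i (k + 1) • ((k : K) + 1) • MvPolynomial.pderiv (Sum.inr (i, k)))

/-- The creation exponent on a single Fock space. -/
def creOsc (V : VertexData K n) : PowerSeries (Module.End K (Osc K n)) :=
  PowerSeries.mk fun
    | 0 => 0
    | k + 1 => LinearMap.mulLeft K (V.crePoly k)

/-- The annihilation exponent on a single Fock space. -/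
def annOsc (s : K) (V : VertexData K n) : PowerSeries (Module.End K (Osc K n)) :=
  PowerSeries.mk fun
    | 0 => 0
    | k + 1 => (V.annDer s k).toLinearMap

theorem constSectors_coeff_creOsc (s : K) (V : VertexData K n) (k : ℕ) :
    constSectors (PowerSeries.coeff k V.creOsc) = PowerSeries.coeff k (V.creExponent s) := by
  rcases k with _ | k
  · simp [creOsc, creExponent]
  · rw [creOsc, creExponent, PowerSeries.coeff_mk, PowerSeries.coeff_mk,
      if_neg (Nat.succ_ne_zero k)]
    have ha : ∀ i : Fin n, aMode s i (-((k + 1 : ℕ) : ℤ)) =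
        constSectors (LinearMap.mulLeft K (MvPolynomial.X (Sum.inl (i, k)))) := fun i => rfl
    have hb : ∀ i : Fin n, bMode (K := K) i (-((k + 1 : ℕ) : ℤ)) =
        constSectors (LinearMap.mulLeft K (MvPolynomial.X (Sum.inr (i, k)))) := fun i => rfl
    simp only [ha, hb, ← map_smul, ← map_add, ← map_sum]
    refine congrArg constSectors (LinearMap.ext fun p => ?_)
    simp [crePoly, Finset.sum_mul, add_mul]

theorem constSectors_coeff_annOsc (s : K) (V : VertexData K n) (k : ℕ) :
    constSectors (PowerSeries.coeff k (V.annOsc s)) = PowerSeries.coeff k (V.annExponent s) := by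
  rcases k with _ | k
  · simp [annOsc, annExponent]
  · rw [annOsc, annExponent, PowerSeries.coeff_mk, PowerSeries.coeff_mk,
      if_neg (Nat.succ_ne_zero k)]
    have ha : ∀ i : Fin n, aMode s i ((k + 1 : ℕ) : ℤ) =
        constSectors (aDer s i k).toLinearMap := fun i => by
      refine congrArg constSectors (LinearMap.ext fun p => ?_)
      simp [aDer, derivation_sum_apply]
    have hb : ∀ i : Fin n, bMode (K := K) i ((k + 1 : ℕ) : ℤ) =
        constSectors (((k : K) + 1) • (MvPolynomial.pderiv (Sum.inr (i, k))).toLinearMap) :=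
      fun i => rfl
    simp only [ha, hb, ← map_smul, ← map_add, ← map_sum]
    refine congrArg constSectors (LinearMap.ext fun p => ?_)
    simp [annDer, derivation_sum_apply]

/-- The contraction of the annihilation part of `V` with the creation part of `W`. -/
def contraction (s : K) (V W : VertexData K n) (k : ℕ) : K :=
  ∑ i, ∑ j, V.aAnn i k * aComm s i j (k : ℤ) * W.aCre j k + ∑ i, V.bAnn i k * k * W.bCre i k

/-- Annihilation modes are derivations with constant coefficients. The value of the constant is
irrelevant: a second derivation kills it, so the annihilation modes commute. -/
theorem annDer_X (s : K) (V : VertexData K n) (k : ℕ) (x : OscVar n) :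
    ∃ c : K, V.annDer s k (MvPolynomial.X x) = MvPolynomial.C c := by
  classical
  refine ⟨∑ i, (V.aAnn i (k + 1) * ∑ j, aComm s i j ((k : ℤ) + 1) *
    (Pi.single x 1 : OscVar n → K) (Sum.inl (j, k)) +
    V.bAnn i (k + 1) * (((k : K) + 1) * (Pi.single x 1 : OscVar n → K) (Sum.inr (i, k)))), ?_⟩
  have h : ∀ y : OscVar n, MvPolynomial.pderiv y (MvPolynomial.X x : Osc K n) =
      MvPolynomial.C ((Pi.single x 1 : OscVar n → K) y) := fun y => by
    rw [MvPolynomial.pderiv_X, Pi.single_apply, Pi.single_apply]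
    simp only [@eq_comm _ x y]
    split_ifs <;> simp
  simp only [annDer, aDer, derivation_sum_apply, Derivation.add_apply,
    Derivation.smul_apply, h, MvPolynomial.smul_eq_C_mul, ← map_mul, ← map_sum, ← map_add]

theorem annDer_crePoly (s : K) (V W : VertexData K n) (k l : ℕ) :
    V.annDer s k (W.crePoly l) =
      if l = k then MvPolynomial.C (V.contraction s W (k + 1)) else 0 := by
  classical
  have hl : ∀ i j : Fin n, MvPolynomial.pderiv (Sum.inl (i, k))
      (MvPolynomial.X (Sum.inl (j, l)) : Osc K n) =
      if l = k then if j = i then 1 else 0 else 0 := fun i j => by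
    rw [MvPolynomial.pderiv_X, Pi.single_apply]
    by_cases h : l = k <;> by_cases h' : j = i <;> simp [h, h']
  have hr : ∀ i j : Fin n, MvPolynomial.pderiv (Sum.inr (i, k))
      (MvPolynomial.X (Sum.inr (j, l)) : Osc K n) =
      if l = k then if j = i then 1 else 0 else 0 := fun i j => by
    rw [MvPolynomial.pderiv_X, Pi.single_apply]
    by_cases h : l = k <;> by_cases h' : j = i <;> simp [h, h']
  have hlr : ∀ i j : Fin n, MvPolynomial.pderiv (Sum.inl (i, k))
      (MvPolynomial.X (Sum.inr (j, l)) : Osc K n) = 0 := fun i j => by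
    rw [MvPolynomial.pderiv_X, Pi.single_apply]; simp
  have hrl : ∀ i j : Fin n, MvPolynomial.pderiv (Sum.inr (i, k))
      (MvPolynomial.X (Sum.inl (j, l)) : Osc K n) = 0 := fun i j => by
    rw [MvPolynomial.pderiv_X, Pi.single_apply]; simp
  simp only [annDer, aDer, crePoly, derivation_sum_apply, Derivation.add_apply,
    Derivation.smul_apply, map_sum, map_add, Derivation.map_smul, hl, hr, hlr, hrl, smul_zero,
    add_zero]
  split_ifs with h
  · subst h
    simp only [smul_ite, smul_zero, Finset.sum_add_distrib, contraction, map_add, map_sum,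
      Finset.sum_ite_eq, Finset.mem_univ, if_true, Finset.sum_const_zero, zero_add,
      Finset.smul_sum]
    congr 1
    · rw [Finset.sum_comm]
      refine Finset.sum_congr rfl fun i _ => Finset.sum_congr rfl fun j _ => ?_
      simp only [MvPolynomial.smul_eq_C_mul, map_mul]
      push_cast
      ring
    · refine Finset.sum_congr rfl fun i _ => ?_
      simp only [MvPolynomial.smul_eq_C_mul, map_mul]
      push_cast
      ring
  · simp

end VertexData

theorem single_mem_fockLE {N : ℤ} {p : Osc K n} (hp : p ∈ levelLE K n N) (l : Sector n) :
    (Finsupp.single l p : Fock K n) ∈ fockLE K n N := fun l' => by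
  classical
  rw [Finsupp.single_apply]
  split_ifs
  · exact hp
  · exact Submodule.zero_mem _

theorem levelLE_of_neg {N : ℤ} (h : N < 0) {p : Osc K n} (hp : p ∈ levelLE K n N) : p = 0 := by
  have := fockLE_neg h (single_mem_fockLE hp 0)
  simpa using this

theorem X_mul_levelLE {N : ℤ} (x : OscVar n) {p : Osc K n} (hp : p ∈ levelLE K n N) :
    MvPolynomial.X x * p ∈ levelLE K n (N + varLevel x) := by
  rw [levelLE] at hp
  induction hp using Submodule.span_induction with
  | mem y hy =>
    obtain ⟨d, hd, rfl⟩ := hy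
    refine Submodule.subset_span ⟨Finsupp.single x 1 + d, ?_, ?_⟩
    · rw [map_add, Finsupp.weight_single]; push_cast; simp; linarith
    · rw [MvPolynomial.X, MvPolynomial.monomial_mul, one_mul]
  | zero => simp
  | add y z _ _ hy hz => rw [mul_add]; exact Submodule.add_mem _ hy hz
  | smul c y _ hy => rw [mul_smul_comm]; exact Submodule.smul_mem _ _ hy

namespace VertexData

theorem coeff_creOsc_mul_comm (V W : VertexData K n) (k l : ℕ) :
    Commute (PowerSeries.coeff k V.creOsc) (PowerSeries.coeff l W.creOsc) := by
  rcases k with _ | k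
  · simp [creOsc]
  rcases l with _ | l
  · simp [creOsc]
  simp only [creOsc, PowerSeries.coeff_mk]
  refine LinearMap.ext fun p => ?_
  simp only [Module.End.mul_apply, LinearMap.mulLeft_apply]
  ring

theorem coeff_annOsc_mul_comm (s : K) (V W : VertexData K n) (k l : ℕ) :
    Commute (PowerSeries.coeff k (V.annOsc s)) (PowerSeries.coeff l (W.annOsc s)) := by
  rcases k with _ | k
  · simp [annOsc]
  rcases l with _ | l
  · simp [annOsc]
  simp only [annOsc, PowerSeries.coeff_mk]
  have h : ⁅V.annDer s k, W.annDer s l⁆ = 0 := MvPolynomial.derivation_ext fun x => by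
    obtain ⟨c, hc⟩ := V.annDer_X s k x
    obtain ⟨d, hd⟩ := W.annDer_X s l x
    rw [Derivation.commutator_apply, hc, hd]
    simp
  refine LinearMap.ext fun p => ?_
  have := DFunLike.congr_fun h p
  rw [Derivation.commutator_apply, Derivation.zero_apply, sub_eq_zero] at this
  exact this

/-- By the Leibniz rule, the commutator of a derivation with multiplication by P is multiplication
by the derivative of P, here a constant. -/
theorem commutator_annOsc_creOsc (s : K) (V W : VertexData K n) (k l : ℕ) :
    PowerSeries.coeff k (V.annOsc s) * PowerSeries.coeff l W.creOsc -
      PowerSeries.coeff l W.creOsc * PowerSeries.coeff k (V.annOsc s) =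
      if l = k then algebraMap K (Module.End K (Osc K n)) (V.contraction s W k) else 0 := by
  rcases k with _ | k
  · have : V.contraction s W 0 = 0 := by simp [contraction, aComm]
    simp [annOsc, this]
  rcases l with _ | l
  · simp [creOsc]
  simp only [annOsc, creOsc, PowerSeries.coeff_mk]
  refine LinearMap.ext fun p => ?_
  have h := V.annDer_crePoly s W k l
  simp only [LinearMap.sub_apply, Module.End.mul_apply, LinearMap.mulLeft_apply,
    Derivation.coeFn_coe, Derivation.leibniz, smul_eq_mul, h,
    add_sub_cancel_left, Nat.add_right_cancel_iff]
  split_ifs with hlk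
  · rw [Module.algebraMap_end_apply, MvPolynomial.smul_eq_C_mul, mul_comm]
  · simp

/-- The coefficient of `z^q` in the creation part on a single Fock space. -/
def creMode (V : VertexData K n) : ℚ → Module.End K (Osc K n) :=
  extendZero fun i => PowerSeries.coeff i (expSeries K V.creOsc)

/-- The coefficient of `z^{-t}` in the annihilation part on a single Fock space. -/
def annMode (s : K) (V : VertexData K n) : ℚ → Module.End K (Osc K n) :=
  extendZero fun j => PowerSeries.coeff j (expSeries K (V.annOsc s))

theorem cre_single (s : K) (V : VertexData K n) (i : ℕ) (l : Sector n) (p : Osc K n) :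
    V.cre s i (Finsupp.single l p) = Finsupp.single l (V.creMode i p) := by
  have h : constSectors (PowerSeries.coeff i (expSeries K V.creOsc)) = V.cre s i :=
    map_coeff_expSeries (K := K) (R := Module.End K (Osc K n)) (R' := Module.End K (Fock K n))
      constSectors (V.constSectors_coeff_creOsc s) i
  rw [← h, constSectors_single, creMode, extendZero_natCast]

theorem ann_single (s : K) (V : VertexData K n) (j : ℕ) (l : Sector n) (p : Osc K n) :
    V.ann s j (Finsupp.single l p) = Finsupp.single l (V.annMode s j p) := by
  have h : constSectors (PowerSeries.coeff j (expSeries K (V.annOsc s))) = V.ann s j :=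
    map_coeff_expSeries (K := K) (R := Module.End K (Osc K n)) (R' := Module.End K (Fock K n))
      constSectors (V.constSectors_coeff_annOsc s) j
  rw [← h, constSectors_single, annMode, extendZero_natCast]

theorem zeroPart_single (V : VertexData K n) (t : ℚ) (l : Sector n) (p : Osc K n) :
    V.zeroPart t (Finsupp.single l p) =
      if V.expo l = t then Finsupp.single (l + V.shift) (V.scal l • p) else 0 := by
  rw [zeroPart, Finsupp.lsum_single]
  split_ifs <;> simp

theorem creMode_comm (V W : VertexData K n) (p q : ℚ) :
    Commute (V.creMode p) (W.creMode q) :=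
  commute_extendZero (fun i j => commute_coeff_expSeries (fun l =>
    (commute_coeff_expSeries (fun k => W.coeff_creOsc_mul_comm V l k) i).symm) j) p q

theorem annMode_comm (s : K) (V W : VertexData K n) (p q : ℚ) :
    Commute (V.annMode s p) (W.annMode s q) :=
  commute_extendZero (fun i j => commute_coeff_expSeries (fun l =>
    (commute_coeff_expSeries (fun k => W.coeff_annOsc_mul_comm s V l k) i).symm) j) p q

/-- The commutation relation of annihilation and creation parts, cleared of denominators. -/
theorem annMode_creMode_exchange [CharZero K] (s : K) (V W : VertexData K n) {α β : K}
    (h : ∀ k : ℕ, k * V.contraction s W k = β ^ k - α ^ k) (t q : ℚ) :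
    V.annMode s t * W.creMode q - β • (V.annMode s (t - 1) * W.creMode (q - 1)) =
      W.creMode q * V.annMode s t - α • (W.creMode (q - 1) * V.annMode s (t - 1)) :=
  extendZero_expSeries_exchange (by simp [annOsc]) (by simp [creOsc])
    (V.coeff_annOsc_mul_comm s V) (V.commutator_annOsc_creOsc s W) h t q

theorem annMode_creMode_comm [CharZero K] (s : K) (V W : VertexData K n)
    (h : ∀ k : ℕ, k * V.contraction s W k = 0) (t q : ℚ) :
    Commute (V.annMode s t) (W.creMode q) := by
  refine commute_extendZero (fun i j => commute_coeff_expSeries (fun l =>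
    (commute_coeff_expSeries (fun k => ?_) i).symm) j) t q
  have hc : V.contraction s W k = 0 := by
    rcases Nat.eq_zero_or_pos k with rfl | hk
    · simp [contraction, aComm]
    · exact (mul_eq_zero.mp (h k)).resolve_left (by exact_mod_cast hk.ne')
  have := V.commutator_annOsc_creOsc s W k l
  rw [hc, map_zero, ite_self, sub_eq_zero] at this
  exact this.symm

/-! ### Level estimates and the vertex operator without its zero modes -/

theorem annMode_levelLE (s : K) (V : VertexData K n) (j : ℤ) {N : ℤ} {p : Osc K n}
    (hp : p ∈ levelLE K n N) : V.annMode s j p ∈ levelLE K n (N - j) := by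
  rcases lt_or_ge j 0 with hj | hj
  · rw [annMode, extendZero_of_neg _ (by exact_mod_cast hj)]
    exact Submodule.zero_mem _
  · lift j to ℕ using hj
    have := ann_fockLE s V j (single_mem_fockLE hp 0) 0
    rw [ann_single, Finsupp.single_eq_same] at this
    exact this

theorem creOsc_pow_levelLE (V : VertexData K n) (m : ℕ) : ∀ (k : ℕ) {N : ℤ} {p : Osc K n},
    p ∈ levelLE K n N → PowerSeries.coeff k (V.creOsc ^ m) p ∈ levelLE K n (N + k) := by
  induction m with
  | zero =>
    intro k N p hp
    rw [pow_zero, PowerSeries.coeff_one]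
    split_ifs with hk
    · subst hk; simpa using hp
    · simp
  | succ m ih =>
    intro k N p hp
    rw [pow_succ, PowerSeries.coeff_mul, LinearMap.sum_apply]
    refine Submodule.sum_mem _ fun x hx => ?_
    have h1 : PowerSeries.coeff x.2 V.creOsc p ∈ levelLE K n (N + x.2) := by
      rcases x.2 with _ | l
      · simp [creOsc]
      · simp only [creOsc, PowerSeries.coeff_mk, LinearMap.mulLeft_apply, crePoly,
          Finset.sum_mul, add_mul, smul_mul_assoc]
        exact Submodule.sum_mem _ fun i _ => Submodule.add_mem _
          (Submodule.smul_mem _ _ (X_mul_levelLE (Sum.inl (i, l)) hp))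
          (Submodule.smul_mem _ _ (X_mul_levelLE (Sum.inr (i, l)) hp))
    have h := ih x.1 h1
    have e : N + (x.2 : ℤ) + (x.1 : ℤ) = N + (k : ℤ) := by
      have := Finset.HasAntidiagonal.mem_antidiagonal.mp hx
      omega
    rw [e] at h
    exact h

theorem creMode_levelLE (V : VertexData K n) (q : ℚ) {N : ℤ} {p : Osc K n}
    (hp : p ∈ levelLE K n N) : V.creMode q p ∈ levelLE K n ⌊(N : ℚ) + q⌋ := by
  by_cases hq : ∃ i : ℕ, (i : ℚ) = q
  · obtain ⟨i, rfl⟩ := hq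
    have e : ⌊(N : ℚ) + (i : ℚ)⌋ = N + i := by
      rw [Int.floor_add_natCast, Int.floor_intCast]
    rw [e, creMode, extendZero_natCast, expSeries, PowerSeries.coeff_mk, LinearMap.sum_apply]
    exact Submodule.sum_mem _ fun m _ => Submodule.smul_mem _ _ (creOsc_pow_levelLE V m i hp)
  · push Not at hq
    rw [creMode, extendZero_eq_zero _ hq]
    exact Submodule.zero_mem _

theorem finite_support_annMode (s : K) (V : VertexData K n) (p : Osc K n) :
    {j : ℤ | V.annMode s j p ≠ 0}.Finite := by
  obtain ⟨N, hN⟩ := exists_levelLE p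
  refine (Set.finite_Icc 0 N).subset fun j hj => ?_
  constructor
  · by_contra h
    refine hj ?_
    rw [annMode, extendZero_of_neg _ (by exact_mod_cast not_le.mp h), LinearMap.zero_apply]
  · by_contra h
    exact hj (levelLE_of_neg (by omega) (V.annMode_levelLE s j hN))

theorem finite_support_comp_annMode (s : K) (V : VertexData K n)
    (L : ℤ → Module.End K (Osc K n)) (p : Osc K n) :
    (Function.support fun j : ℤ => L j (V.annMode s j p)).Finite :=
  (V.finite_support_annMode s p).subset fun j hj h => hj (by simp only [h, map_zero])

/-- The coefficient of `z^q` in the vertex operator without its zero mode part, on a single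
Fock space. -/
def field (s : K) (V : VertexData K n) (q : ℚ) : Module.End K (Osc K n) where
  toFun p := ∑ᶠ j : ℤ, V.creMode (q + j) (V.annMode s j p)
  map_add' x y := by
    rw [← finsum_add_distrib (V.finite_support_comp_annMode s (fun j => V.creMode (q + j)) x)
      (V.finite_support_comp_annMode s (fun j => V.creMode (q + j)) y)]
    simp only [map_add]
  map_smul' c x := by
    rw [RingHom.id_apply,
      smul_finsum' c (V.finite_support_comp_annMode s (fun j => V.creMode (q + j)) x)]
    simp only [map_smul]

theorem field_apply (s : K) (V : VertexData K n) (q : ℚ) (p : Osc K n) :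
    V.field s q p = ∑ᶠ j : ℤ, V.creMode (q + j) (V.annMode s j p) := rfl

theorem map_field_apply (s : K) {M : Type*} [AddCommGroup M]
    [Module K M] (V : VertexData K n) (T : Osc K n →ₗ[K] M) (q : ℚ) (p : Osc K n) :
    T (V.field s q p) = ∑ᶠ j : ℤ, T (V.creMode (q + j) (V.annMode s j p)) :=
  T.toAddMonoidHom.map_finsum
    (V.finite_support_comp_annMode s (fun j => V.creMode (q + j)) p)

/-- On one summand the zero mode part selects a single power of z, so in the double sum the creation
index i is forced by the annihilation index j. Letting j run over all of ℤ adds only zero terms and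
makes shifts of j bijective. -/
theorem mode_single (s : K) (V : VertexData K n) (r : ℚ) (l : Sector n) (p : Osc K n) :
    V.mode s r (Finsupp.single l p) =
      Finsupp.single (l + V.shift) (V.scal l • V.field s (r - V.expo l) p) := by
  set T : Osc K n →ₗ[K] Fock K n := V.scal l • Finsupp.lsingle (l + V.shift) with hT
  have hTa : ∀ x, T x = Finsupp.single (l + V.shift) (V.scal l • x) := fun x => by simp [hT]
  have hterm : ∀ x : ℕ × ℕ, V.term s r (Finsupp.single l p) x =
      if V.expo l = r - x.1 + x.2 then T (V.creMode x.1 (V.annMode s x.2 p)) else 0 := fun x => by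
    rw [term, zeroPart_single]
    split_ifs
    · rw [ann_single, cre_single, map_smul, map_smul, hTa]
    · simp
  rw [← hTa, map_field_apply]
  change ∑ᶠ x : ℕ × ℕ, V.term s r (Finsupp.single l p) x = _
  rw [← finsum_mem_support, ← finsum_mem_support (fun j : ℤ => T _)]
  have hval : ∀ x ∈ Function.support (V.term s r (Finsupp.single l p)),
      (x.1 : ℚ) = r - V.expo l + x.2 ∧ V.term s r (Finsupp.single l p) x =
        T (V.creMode (r - V.expo l + ((x.2 : ℤ) : ℚ)) (V.annMode s ((x.2 : ℤ) : ℚ) p)) :=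
    fun x hx => by
      have h : V.expo l = r - x.1 + x.2 := by
        by_contra h
        exact hx (by rw [hterm, if_neg h])
      have h1 : (x.1 : ℚ) = r - V.expo l + x.2 := by rw [h]; ring
      refine ⟨h1, ?_⟩
      rw [hterm, if_pos h, Int.cast_natCast, ← h1]
  refine finsum_mem_eq_of_bijOn (fun x => (x.2 : ℤ)) ⟨fun x hx => ?_, fun x hx y hy hxy => ?_,
    fun j hj => ?_⟩ fun x hx => (hval x hx).2
  · rw [Function.mem_support, ← (hval x hx).2]
    exact hx
  · have h2 : x.2 = y.2 := Int.ofNat_injective hxy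
    refine Prod.ext ?_ h2
    have := (hval x hx).1.trans ((congrArg (fun t : ℕ => r - V.expo l + t) h2).trans
      (hval y hy).1.symm)
    exact_mod_cast this
  · have hj0 : 0 ≤ j := by
      by_contra h
      refine hj (show T (V.creMode _ (V.annMode s j p)) = 0 from ?_)
      rw [annMode, extendZero_of_neg _ (by exact_mod_cast not_le.mp h), LinearMap.zero_apply,
        map_zero, map_zero]
    have hi : ∃ i : ℕ, (i : ℚ) = r - V.expo l + j := by
      by_contra h
      push Not at h
      refine hj (show T (V.creMode _ (V.annMode s j p)) = 0 from ?_)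
      rw [creMode, extendZero_eq_zero _ h, LinearMap.zero_apply, map_zero]
    lift j to ℕ using hj0
    obtain ⟨i, hi⟩ := hi
    refine ⟨(i, j), ?_, rfl⟩
    rw [Int.cast_natCast] at hi
    rw [Function.mem_support, hterm, if_pos (by rw [hi]; ring), hi]
    exact hj

end VertexData

/-! ## The Serre relation from exchange relations -/

section Serre

variable {K R : Type*} [Field K] [Ring R] [Algebra K R]

/-- The modes of `Φ X Y - (a + a⁻¹) X Φ Y + X Y Φ`. -/
def serre (a : K) (Φ X Y : ℚ → R) (r r₁ r₂ : ℚ) : R :=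
  Φ r * X r₁ * Y r₂ - (a + a⁻¹) • (X r₁ * Φ r * Y r₂) + X r₁ * Y r₂ * Φ r

/-- The modes of the sum of `Φ X Y - (a + a⁻¹) X Φ Y + X Y Φ` and of the same expression with
`X` and `Y` exchanged. -/
def symSerre (a : K) (Φ X Y : ℚ → R) (x : ℚ × ℚ × ℚ) : R :=
  serre a Φ X Y x.1 x.2.1 x.2.2 + serre a Φ Y X x.1 x.2.2 x.2.1

/-- With x = z/w₁ and y = z/w₂, bringing Φ to the left produces the coefficient (1 − abx)(1 − aby) −
(a + a⁻¹)(a − bx)(1 − aby) + (a − bx)(a − by). Its constant and xy terms cancel, leaving b(a² −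
1)(ay − a⁻¹x). This is where the factor a + a⁻¹ of the Serre relation is needed. -/
theorem serre_exchange {a b : K} (ha : a ≠ 0) {Φ X Y : ℚ → R}
    (hX : ∀ r t, X t * Φ r - (a * b) • (X (t + 1) * Φ (r - 1)) =
      a • (Φ r * X t) - b • (Φ (r - 1) * X (t + 1)))
    (hY : ∀ r t, Y t * Φ r - (a * b) • (Y (t + 1) * Φ (r - 1)) =
      a • (Φ r * Y t) - b • (Φ (r - 1) * Y (t + 1))) (r t u : ℚ) :
    serre a Φ X Y r t u - (a * b) • serre a Φ X Y (r - 1) (t + 1) u -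
        (a * b) • (serre a Φ X Y (r - 1) t (u + 1) -
          (a * b) • serre a Φ X Y (r - 1 - 1) (t + 1) (u + 1)) =
      (b * (a ^ 2 - 1)) • (Φ (r - 1) *
        (a • (X t * Y (u + 1)) - a⁻¹ • (X (t + 1) * Y u))) := by
  have h1 := congrArg (X t * ·) (hY r u)
  have h2 := congrArg (X (t + 1) * ·) (hY (r - 1) u)
  have h3 := congrArg (· * Y u) (hX r t)
  have h4 := congrArg (· * Y (u + 1)) (hX (r - 1) t)
  simp only [mul_sub, sub_mul, smul_mul_assoc, mul_smul_comm, mul_assoc] at h1 h2 h3 h4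
  simp only [serre, mul_sub, mul_smul_comm, mul_assoc]
  -- `h1` and `h2` carry Φ past Y behind X; `h3` and `h4` then carry Φ past X. The coefficients of
  -- the latter combine XΦY as it comes from XYΦ (a and −b) with the middle term of the Serre
  -- expression.
  linear_combination (norm := skip) h1 - (a * b) • h2 + (a - (a + a⁻¹)) • h3 +
    (-b + a * b * (a + a⁻¹)) • h4
  match_scalars <;> field_simp <;> ring

/-- The remainders of the two orderings add up to a multiple of (z/(w₁w₂)) Φ times (w₁ − a⁻²w₂) XY +
(w₂ − a⁻²w₁) YX, which vanishes by `hXY`. -/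
theorem symSerre_exchange {a b : K} (ha : a ≠ 0) {Φ X Y : ℚ → R}
    (hX : ∀ r t, X t * Φ r - (a * b) • (X (t + 1) * Φ (r - 1)) =
      a • (Φ r * X t) - b • (Φ (r - 1) * X (t + 1)))
    (hY : ∀ r t, Y t * Φ r - (a * b) • (Y (t + 1) * Φ (r - 1)) =
      a • (Φ r * Y t) - b • (Φ (r - 1) * Y (t + 1)))
    (hXY : ∀ t u, X t * Y u - (a ^ 2)⁻¹ • (X (t + 1) * Y (u - 1)) =
      (a ^ 2)⁻¹ • (Y u * X t) - Y (u - 1) * X (t + 1)) (x : ℚ × ℚ × ℚ) :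
    symSerre a Φ X Y x - (a * b) • symSerre a Φ X Y (x + (-1, 1, 0)) =
      (a * b) • (symSerre a Φ X Y (x + (-1, 0, 1)) -
        (a * b) • symSerre a Φ X Y (x + (-1, 0, 1) + (-1, 1, 0))) := by
  obtain ⟨r, t, u⟩ := x
  have h1 := serre_exchange ha hX hY r t u
  have h2 := serre_exchange ha hY hX r u t
  have h3 := congrArg (Φ (r - 1) * ·) (hXY t (u + 1))
  simp only [mul_sub, mul_smul_comm, add_sub_cancel_right] at h1 h2 h3
  simp only [symSerre, Prod.mk_add_mk, add_zero, ← sub_eq_add_neg]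
  linear_combination (norm := skip) h1 + h2 + (b * (a ^ 2 - 1) * a) • h3
  match_scalars <;> field_simp <;> ring

/-! ### Cancelling the factors 1 − βT by boundedness -/

theorem eq_zero_of_eq_smul {A M : Type*} [AddCommMonoid A] [AddCommGroup M] [Module K M]
    {f : A → M} {β : K} {d : A} (h : ∀ x, f x = β • f (x + d))
    (hf : ∀ x, ∃ k : ℕ, f (x + k • d) = 0) (x : A) : f x = 0 := by
  have hk : ∀ k : ℕ, ∀ x, f x = β ^ k • f (x + k • d) := fun k => by
    induction k with
    | zero => simp
    | succ k ih => intro x; rw [ih, h, smul_smul, pow_succ, succ_nsmul, add_assoc]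
  obtain ⟨k, h0⟩ := hf x
  rw [hk k, h0, smul_zero]

/-- Injectivity of `(1 - β T^d) (1 - β T^e)`, where `T^d` is the shift by `d`, on functions that
vanish where a linear form `L` that decreases along `d` and `e` is small. -/
theorem eq_zero_of_shift_eq {M : Type*} [AddCommGroup M] [Module K M]
    {f : ℚ × ℚ × ℚ → M} {β : K} {d e : ℚ × ℚ × ℚ}
    (h : ∀ x, f x - β • f (x + d) = β • (f (x + e) - β • f (x + e + d)))
    (L : ℚ × ℚ × ℚ →+ ℚ) (hd : L d = -1) (he : L e = -1) {B : ℚ} (hf : ∀ x, L x < B → f x = 0)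
    (x : ℚ × ℚ × ℚ) : f x = 0 := by
  have hL : ∀ x c, L c = -1 → ∃ k : ℕ, L (x + k • c) < B := fun x c hc => by
    obtain ⟨k, hk⟩ := exists_nat_gt (L x - B)
    refine ⟨k, ?_⟩
    rw [map_add, map_nsmul, hc, nsmul_eq_mul]
    linarith
  -- The outer factor, along `e`, is cancelled first; the inner one, along `d`, is cancelled
  -- afterwards.
  have hg : ∀ x, f x - β • f (x + d) = 0 := by
    refine eq_zero_of_eq_smul h fun x => ?_
    obtain ⟨k, hk⟩ := hL x e he
    refine ⟨k, ?_⟩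
    rw [hf _ hk, hf _ (by rw [map_add L _ d, hd]; linarith), smul_zero, sub_zero]
  refine eq_zero_of_eq_smul (fun x => sub_eq_zero.mp (hg x)) (fun x => ?_) x
  obtain ⟨k, hk⟩ := hL x d hd
  exact ⟨k, hf _ hk⟩

/-- The symmetrized Serre expression is invariant under reversing all products. Passing to the
opposite ring and inverting the variables reduces the case with the pole in ΦX to the case with the
pole in XΦ. -/
theorem symSerre_exchange_op {a b : K} (ha : a ≠ 0) {Φ X Y : ℚ → R}
    (hX : ∀ r t, Φ r * X t - (a * b) • (Φ (r + 1) * X (t - 1)) =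
      a • (X t * Φ r) - b • (X (t - 1) * Φ (r + 1)))
    (hY : ∀ r t, Φ r * Y t - (a * b) • (Φ (r + 1) * Y (t - 1)) =
      a • (Y t * Φ r) - b • (Y (t - 1) * Φ (r + 1)))
    (hXY : ∀ t u, X t * Y u - (a ^ 2)⁻¹ • (X (t + 1) * Y (u - 1)) =
      (a ^ 2)⁻¹ • (Y u * X t) - Y (u - 1) * X (t + 1)) (x : ℚ × ℚ × ℚ) :
    symSerre a Φ X Y x - (a * b) • symSerre a Φ X Y (x + (1, -1, 0)) =
      (a * b) • (symSerre a Φ X Y (x + (1, 0, -1)) -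
        (a * b) • symSerre a Φ X Y (x + (1, 0, -1) + (1, -1, 0))) := by
  set o : (ℚ → R) → ℚ → Rᵐᵒᵖ := fun F r => MulOpposite.op (F (-r)) with ho
  have hs : ∀ x, symSerre a (o Φ) (o X) (o Y) x = MulOpposite.op (symSerre a Φ X Y (-x)) :=
    fun x => by
      apply MulOpposite.unop_injective
      simp only [symSerre, serre, ho, MulOpposite.unop_add, MulOpposite.unop_sub,
        MulOpposite.unop_mul, MulOpposite.unop_smul, MulOpposite.unop_op, mul_assoc,
        Prod.fst_neg, Prod.snd_neg]
      abel
  have key := symSerre_exchange (R := Rᵐᵒᵖ) (Φ := o Φ) (X := o X) (Y := o Y) (b := b) ha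
    (fun r t => by
      have := congrArg MulOpposite.op (hX (-r) (-t))
      simpa only [MulOpposite.op_sub, MulOpposite.op_mul, MulOpposite.op_smul, ho, neg_add',
        neg_sub', sub_neg_eq_add] using this)
    (fun r t => by
      have := congrArg MulOpposite.op (hY (-r) (-t))
      simpa only [MulOpposite.op_sub, MulOpposite.op_mul, MulOpposite.op_smul, ho, neg_add',
        neg_sub', sub_neg_eq_add] using this)
    (fun t u => by
      -- The exchange relation of X and Y is its own mirror image up to rearranging terms; the index
      -- shift by one aligns the two.
      have := congrArg MulOpposite.op (hXY (-t - 1) (-u + 1))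
      simp only [MulOpposite.op_sub, MulOpposite.op_mul, MulOpposite.op_smul,
        sub_add_cancel, add_sub_cancel_right] at this
      simp only [ho, neg_add', neg_sub', sub_neg_eq_add]
      linear_combination (norm := module) this) (-x)
  simp only [hs] at key
  have := congrArg MulOpposite.unop key
  simpa [neg_add, add_comm, add_left_comm] using this

end Serre

namespace VertexData

/-! ## Operator product expansions and locality -/

/-- The coefficient of `z^q w^{q'}` in the normally ordered product of the vertex operators
without their zero mode parts. -/
def normalField (s : K) (V W : VertexData K n) (q q' : ℚ) (p : Osc K n) : Osc K n :=
  ∑ᶠ x : ℤ × ℤ, V.creMode (q + x.2) (W.creMode (q' + x.1) (V.annMode s x.2 (W.annMode s x.1 p)))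

theorem finite_support_pair (s : K) (V W : VertexData K n)
    (L : ℤ × ℤ → Module.End K (Osc K n)) (M : ℤ → Module.End K (Osc K n)) (p : Osc K n) :
    (Function.support fun x : ℤ × ℤ =>
      L x (V.annMode s x.2 (M x.1 (W.annMode s x.1 p)))).Finite := by
  have h : (⋃ i ∈ {i : ℤ | W.annMode s i p ≠ 0}, Prod.mk i ''
      {j : ℤ | V.annMode s j (M i (W.annMode s i p)) ≠ 0}).Finite :=
    Set.Finite.biUnion (W.finite_support_annMode s p) fun i _ =>
      (V.finite_support_annMode s _).image _
  refine h.subset ?_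
  rintro ⟨i, j⟩ hx
  simp only [Set.mem_iUnion, Set.mem_image, Set.mem_ofPred_eq]
  refine ⟨i, fun h0 => hx ?_, j, fun h0 => hx ?_, rfl⟩
  · simp only [h0, map_zero]
  · simp only [h0, map_zero]

theorem normalField_comm (s : K) (V W : VertexData K n) (q q' : ℚ) (p : Osc K n) :
    V.normalField s W q q' p = W.normalField s V q' q p := by
  rw [normalField, normalField, ← finsum_comp_equiv (Equiv.prodComm ℤ ℤ)]
  refine finsum_congr fun x => ?_
  simp only [Equiv.prodComm_apply, Prod.fst_swap, Prod.snd_swap]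
  have h1 := DFunLike.congr_fun (V.annMode_comm s W x.1 x.2).eq p
  simp only [Module.End.mul_apply] at h1
  rw [h1]
  exact DFunLike.congr_fun (V.creMode_comm W _ _).eq _

theorem field_field (s : K) (V W : VertexData K n) (q q' : ℚ) (p : Osc K n) :
    V.field s q (W.field s q' p) = ∑ᶠ x : ℤ × ℤ,
      V.creMode (q + x.2) (V.annMode s x.2 (W.creMode (q' + x.1) (W.annMode s x.1 p))) := by
  rw [map_field_apply, finsum_curry _ (V.finite_support_pair s W (fun x => V.creMode (q + x.2))
    (fun i => W.creMode (q' + i)) p)]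
  rfl

theorem finsum_sub_smul_eq {ι M : Type*} [AddCommGroup M] [Module K M] (e : ι ≃ ι) {α β : K}
    {F F' G G' : ι → M} (hF : F.support.Finite) (hF' : F'.support.Finite) (hG : G.support.Finite)
    (hG' : G'.support.Finite) (h : ∀ x, F x - β • F' (e x) = G x - α • G' (e x)) :
    ∑ᶠ x, F x - β • ∑ᶠ x, F' x = ∑ᶠ x, G x - α • ∑ᶠ x, G' x := by
  have aux : ∀ (H : ι → M) (c : K), H.support.Finite →
      c • ∑ᶠ x, H x = ∑ᶠ x, c • H (e x) ∧ (Function.support fun x => c • H (e x)).Finite :=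
    fun H c hH => by
      have hH' : (Function.support fun x => H (e x)).Finite := hH.preimage e.injective.injOn
      exact ⟨by rw [← finsum_comp_equiv e, smul_finsum' c hH'],
        hH'.subset (Function.support_const_smul_subset c _)⟩
  rw [(aux F' β hF').1, (aux G' α hG').1, ← finsum_sub_distrib hF (aux F' β hF').2,
    ← finsum_sub_distrib hG (aux G' α hG').2]
  exact finsum_congr h

/-- The operator product expansion, cleared of denominators. -/
theorem field_field_ope [CharZero K] (s : K) (V W : VertexData K n) {α β : K}
    (h : ∀ k : ℕ, k * V.contraction s W k = β ^ k - α ^ k) (q q' : ℚ) (p : Osc K n) :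
    V.field s q (W.field s q' p) - β • V.field s (q + 1) (W.field s (q' - 1) p) =
      V.normalField s W q q' p - α • V.normalField s W (q + 1) (q' - 1) p := by
  -- The exchange relation lowers the annihilation index of `V` by one. This reindexing absorbs it,
  -- so that the identity can be checked term by term.
  let e : ℤ × ℤ ≃ ℤ × ℤ := (Equiv.refl ℤ).prodCongr (Equiv.subRight 1)
  have h1 : (Function.support fun x : ℤ × ℤ => V.creMode (q + x.2) (V.annMode s x.2
      (W.creMode (q' + x.1) (W.annMode s x.1 p)))).Finite :=
    V.finite_support_pair s W (fun x => V.creMode (q + x.2)) (fun i => W.creMode (q' + i)) p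
  have h2 : (Function.support fun x : ℤ × ℤ => V.creMode (q + 1 + x.2) (V.annMode s x.2
      (W.creMode (q' - 1 + x.1) (W.annMode s x.1 p)))).Finite :=
    V.finite_support_pair s W (fun x => V.creMode (q + 1 + x.2))
      (fun i => W.creMode (q' - 1 + i)) p
  have h3 : (Function.support fun x : ℤ × ℤ => V.creMode (q + x.2) (W.creMode (q' + x.1)
      (V.annMode s x.2 (W.annMode s x.1 p)))).Finite :=
    V.finite_support_pair s W (fun x => V.creMode (q + x.2) * W.creMode (q' + x.1)) (fun _ => 1) p
  have h4 : (Function.support fun x : ℤ × ℤ => V.creMode (q + 1 + x.2) (W.creMode (q' - 1 + x.1)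
      (V.annMode s x.2 (W.annMode s x.1 p)))).Finite :=
    V.finite_support_pair s W (fun x => V.creMode (q + 1 + x.2) * W.creMode (q' - 1 + x.1))
      (fun _ => 1) p
  rw [field_field, field_field, normalField, normalField]
  refine finsum_sub_smul_eq e h1 h2 h3 h4 fun x => ?_
  have hx := DFunLike.congr_fun (V.annMode_creMode_exchange s W h x.2 (q' + x.1))
    (W.annMode s x.1 p)
  have e1 : q + 1 + (((e x).2 : ℤ) : ℚ) = q + x.2 := by simp [e]
  have e2 : q' - 1 + (((e x).1 : ℤ) : ℚ) = q' + x.1 - 1 := by simp [e]; ring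
  have e3 : (((e x).2 : ℤ) : ℚ) = x.2 - 1 := by simp [e]
  have e4 : (e x).1 = x.1 := rfl
  have hx' := congrArg (V.creMode (q + x.2)) hx
  simp only [LinearMap.sub_apply, LinearMap.smul_apply, Module.End.mul_apply, map_sub,
    map_smul] at hx'
  rw [e1, e2, e3, e4]
  exact hx'

/-! ### Vanishing of products of fields for small mode indices -/

theorem field_annMode_comm [CharZero K] (s : K) (V W : VertexData K n)
    (h : ∀ k : ℕ, k * V.contraction s W k = 0) (t q : ℚ) :
    Commute (V.annMode s t) (W.field s q) := by
  refine LinearMap.ext fun p => ?_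
  rw [Module.End.mul_apply, Module.End.mul_apply, map_field_apply, field_apply]
  refine finsum_congr fun j => ?_
  have h1 := DFunLike.congr_fun (V.annMode_creMode_comm s W h t (q + j)).eq (W.annMode s j p)
  have h2 := DFunLike.congr_fun (V.annMode_comm s W t j).eq p
  simp only [Module.End.mul_apply] at h1 h2
  rw [h1, h2]

theorem field_creMode_comm [CharZero K] (s : K) (V W : VertexData K n)
    (h : ∀ k : ℕ, k * V.contraction s W k = 0) (t q : ℚ) :
    Commute (V.field s q) (W.creMode t) := by
  refine LinearMap.ext fun p => ?_
  rw [Module.End.mul_apply, Module.End.mul_apply, map_field_apply, field_apply]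
  refine finsum_congr fun j => ?_
  have h1 := DFunLike.congr_fun (V.annMode_creMode_comm s W h j t).eq p
  have h2 := DFunLike.congr_fun (V.creMode_comm W (q + j) t).eq (V.annMode s j p)
  simp only [Module.End.mul_apply] at h1 h2
  rw [h1, h2]

/-- If `T` commutes with the annihilation part of `V`, then `V(z) T p` is bounded below. -/
theorem field_comp_eq_zero (s : K) (V : VertexData K n) {T : Module.End K (Osc K n)}
    (hT : ∀ t, Commute (V.annMode s t) T) {q : ℚ} {N : ℤ} (hq : N + q < 0) {p : Osc K n}
    (hp : p ∈ levelLE K n N) : V.field s q (T p) = 0 := by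
  rw [field_apply]
  refine (finsum_congr fun j : ℤ => ?_).trans finsum_zero
  have h1 := DFunLike.congr_fun (hT j).eq p
  simp only [Module.End.mul_apply] at h1
  rw [h1]
  rcases le_or_gt j N with hj | hj
  · have : (j : ℚ) ≤ N := by exact_mod_cast hj
    rw [creMode, extendZero_of_neg _ (by linarith), LinearMap.zero_apply]
  · rw [levelLE_of_neg (by omega) (V.annMode_levelLE s j hp), map_zero, map_zero]

theorem field_eq_zero (s : K) (V : VertexData K n) {q : ℚ} {N : ℤ} (hq : N + q < 0) {p : Osc K n}
    (hp : p ∈ levelLE K n N) : V.field s q p = 0 :=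
  V.field_comp_eq_zero s (fun _ => Commute.one_right _) hq hp

/-- Creation by q + j and annihilation by j change the level by q in total; the floor accounts for
rational q. -/
theorem field_levelLE (s : K) (V : VertexData K n) (q : ℚ) {N : ℤ} {p : Osc K n}
    (hp : p ∈ levelLE K n N) : V.field s q p ∈ levelLE K n ⌊(N : ℚ) + q⌋ := by
  rw [field_apply]
  refine finsum_induction (fun x => x ∈ levelLE K n ⌊(N : ℚ) + q⌋) (Submodule.zero_mem _)
    (fun _ _ => Submodule.add_mem _) fun j => ?_
  have := V.creMode_levelLE (q + j) (V.annMode_levelLE s j hp)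
  have e : ((N - j : ℤ) : ℚ) + (q + j) = N + q := by push_cast; ring
  rwa [e] at this

/-- If `T` commutes with the creation part of `V` and kills the vectors of level at most `N`, then
so does `T V(z)`. -/
theorem comp_field_eq_zero (s : K) (V : VertexData K n) {T : Module.End K (Osc K n)}
    (hT : ∀ t, Commute T (V.creMode t)) {N : ℤ} (hN : ∀ p ∈ levelLE K n N, T p = 0) (q : ℚ)
    {p : Osc K n} (hp : p ∈ levelLE K n N) : T (V.field s q p) = 0 := by
  rw [map_field_apply]
  refine (finsum_congr fun j : ℤ => ?_).trans finsum_zero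
  have h1 := DFunLike.congr_fun (hT (q + j)).eq (V.annMode s j p)
  simp only [Module.End.mul_apply] at h1
  rw [h1]
  rcases lt_or_ge j 0 with hj | hj
  · rw [annMode, extendZero_of_neg _ (by exact_mod_cast hj), LinearMap.zero_apply, map_zero,
      map_zero]
  · rw [hN _ (levelLE_mono (by omega) (V.annMode_levelLE s j hp)), map_zero]

/-! ### Zero modes -/

/-- The zero modes of `V` and `W` interact through scalars only: `expo` of one is invariant under
the shift of the other, and `V.scal` is multiplied by `σ` under the shift of `W`. -/
structure ZeroModeLocal (V W : VertexData K n) (σ : K) : Prop where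
  expo_eq : ∀ l, V.expo (l + W.shift) = V.expo l
  scal_eq : ∀ l, V.scal (l + W.shift) = σ * V.scal l

theorem mode_mode_single (s : K) {V W : VertexData K n} {σ : K} (h : ZeroModeLocal V W σ)
    (r r' : ℚ) (l : Sector n) (p : Osc K n) :
    V.mode s r (W.mode s r' (Finsupp.single l p)) = Finsupp.single (l + W.shift + V.shift)
      ((σ * (V.scal l * W.scal l)) • V.field s (r - V.expo l) (W.field s (r' - W.expo l) p)) := by
  rw [mode_single, mode_single, h.expo_eq, h.scal_eq, map_smul, smul_smul]
  congr 2
  ring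

theorem mode_mode_ope [CharZero K] (s : K) {V W : VertexData K n} {σ : K}
    (h : ZeroModeLocal V W σ) {α β : K}
    (hc : ∀ k : ℕ, k * V.contraction s W k = β ^ k - α ^ k) (r r' : ℚ) (l : Sector n)
    (p : Osc K n) :
    V.mode s r (W.mode s r' (Finsupp.single l p)) -
        β • V.mode s (r + 1) (W.mode s (r' - 1) (Finsupp.single l p)) =
      Finsupp.single (l + (V.shift + W.shift)) ((σ * (V.scal l * W.scal l)) •
        (V.normalField s W (r - V.expo l) (r' - W.expo l) p -
          α • V.normalField s W (r + 1 - V.expo l) (r' - 1 - W.expo l) p)) := by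
  have e1 : r + 1 - V.expo l = r - V.expo l + 1 := by ring
  have e2 : r' - 1 - W.expo l = r' - W.expo l - 1 := by ring
  rw [mode_mode_single s h, mode_mode_single s h, e1, e2, ← V.field_field_ope s W hc,
    Finsupp.smul_single, ← Finsupp.single_sub, smul_sub, smul_comm β, add_assoc,
    add_comm W.shift]

/-- Exchange relation of two currents with the same pole. -/
theorem mode_exchange_of_pole [CharZero K] (s : K) {V W : VertexData K n} {σ σ' α α' β : K}
    (h : ZeroModeLocal V W σ) (h' : ZeroModeLocal W V σ')
    (hc : ∀ k : ℕ, k * V.contraction s W k = β ^ k - α ^ k)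
    (hc' : ∀ k : ℕ, k * W.contraction s V k = β ^ k - α' ^ k) (hα : σ * α = σ')
    (hα' : σ' * α' = σ) (t u : ℚ) :
    V.mode s t * W.mode s u - β • (V.mode s (t + 1) * W.mode s (u - 1)) =
      β • (W.mode s u * V.mode s t) - W.mode s (u - 1) * V.mode s (t + 1) := by
  refine Finsupp.lhom_ext fun l p => ?_
  have h1 := mode_mode_ope s h hc t u l p
  -- Taken at these indices and negated, the second expansion is multiplied by −w/z. The two
  -- normally ordered sides then agree, since σα = σ' and σ'α' = σ.
  have h2 := mode_mode_ope s h' hc' (u - 1) (t + 1) l p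
  rw [sub_add_cancel, add_sub_cancel_right] at h2
  simp only [LinearMap.sub_apply, LinearMap.smul_apply, Module.End.mul_apply]
  have h3 := congrArg Neg.neg h2
  rw [neg_sub] at h3
  rw [h1, h3, ← Finsupp.single_neg, add_comm W.shift, normalField_comm s W V,
    normalField_comm s W V, ← hα]
  have h4 : σ * α * α' = σ := by rw [hα, hα']
  congr 1
  simp only [smul_sub, smul_smul]
  match_scalars
  · linear_combination (V.scal l * W.scal l) * (-h4)
  · ring

/-- Exchange relation where one of the two orders has no contraction. -/
theorem mode_exchange_of_no_pole [CharZero K] (s : K) {V W : VertexData K n} {σ σ' α β ρ : K}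
    (h : ZeroModeLocal V W σ) (h' : ZeroModeLocal W V σ')
    (hc : ∀ k : ℕ, k * V.contraction s W k = β ^ k - α ^ k)
    (hc' : ∀ k : ℕ, k * W.contraction s V k = 0) (hρ : ρ * σ' = σ) (t u : ℚ) :
    V.mode s t * W.mode s u - β • (V.mode s (t + 1) * W.mode s (u - 1)) =
      ρ • (W.mode s u * V.mode s t) - (ρ * α) • (W.mode s (u - 1) * V.mode s (t + 1)) := by
  refine Finsupp.lhom_ext fun l p => ?_
  have h1 := mode_mode_ope s h hc t u l p
  have h2 : ∀ t u, W.mode s u (V.mode s t (Finsupp.single l p)) =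
      Finsupp.single (l + (V.shift + W.shift)) ((σ' * (V.scal l * W.scal l)) •
        V.normalField s W (t - V.expo l) (u - W.expo l) p) := fun t u => by
    -- Without contraction the expansion holds with both parameters zero, so the product equals the
    -- normally ordered one up to `σ'`.
    have := mode_mode_ope s h' (α := 0) (β := 0) (by simpa using hc') u t l p
    rw [zero_smul, zero_smul, sub_zero, sub_zero] at this
    rw [this, normalField_comm s W V, add_comm W.shift, mul_comm (W.scal l)]
  simp only [LinearMap.sub_apply, LinearMap.smul_apply, Module.End.mul_apply]
  rw [h1, h2, h2, Finsupp.smul_single, Finsupp.smul_single, ← Finsupp.single_sub, ← hρ]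
  congr 1
  module

/-! ## The Serre relation for vertex operators -/

/-- The case of Φ_+. The annihilation part of Φ passes through X and Y, so on a vector of level at
most N each term vanishes once the index of Φ is below Φ.expo − N, whatever the indices of X and Y.
Both shifts lower that index. -/
theorem symSerre_mode_eq_zero [CharZero K] (s : K) {Φ X Y : VertexData K n} {a b : K} (ha : a ≠ 0)
    (hX : ∀ r t, X.mode s t * Φ.mode s r - (a * b) • (X.mode s (t + 1) * Φ.mode s (r - 1)) =
      a • (Φ.mode s r * X.mode s t) - b • (Φ.mode s (r - 1) * X.mode s (t + 1)))
    (hY : ∀ r t, Y.mode s t * Φ.mode s r - (a * b) • (Y.mode s (t + 1) * Φ.mode s (r - 1)) =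
      a • (Φ.mode s r * Y.mode s t) - b • (Φ.mode s (r - 1) * Y.mode s (t + 1)))
    (hXY : ∀ t u, X.mode s t * Y.mode s u -
        (a ^ 2)⁻¹ • (X.mode s (t + 1) * Y.mode s (u - 1)) =
      (a ^ 2)⁻¹ • (Y.mode s u * X.mode s t) - Y.mode s (u - 1) * X.mode s (t + 1))
    (hcX : ∀ k : ℕ, k * Φ.contraction s X k = 0) (hcY : ∀ k : ℕ, k * Φ.contraction s Y k = 0)
    (heX : ∀ l, Φ.expo (l + X.shift) = Φ.expo l) (heY : ∀ l, Φ.expo (l + Y.shift) = Φ.expo l)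
    (x : ℚ × ℚ × ℚ) : symSerre a (Φ.mode s) (X.mode s) (Y.mode s) x = 0 := by
  refine Finsupp.lhom_ext fun l p => ?_
  obtain ⟨N, hN⟩ := exists_levelLE p
  have hkey := symSerre_exchange (R := Module.End K (Fock K n)) ha hX hY hXY
  rw [LinearMap.zero_apply]
  refine eq_zero_of_shift_eq (β := a * b) (d := (-1, 1, 0)) (e := (-1, 0, 1))
    (f := fun x => symSerre a (Φ.mode s) (X.mode s) (Y.mode s) x (Finsupp.single l p))
    (fun x => DFunLike.congr_fun (hkey x) (Finsupp.single l p))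
    (AddMonoidHom.fst ℚ (ℚ × ℚ)) rfl rfl (B := Φ.expo l - N) (fun x hx => ?_) x
  have hq : (N : ℚ) + (x.1 - Φ.expo l) < 0 := by
    have : x.1 < Φ.expo l - N := hx
    linarith
  have h0 : Φ.field s (x.1 - Φ.expo l) p = 0 := Φ.field_eq_zero s hq hN
  have h1 : ∀ t, Φ.field s (x.1 - Φ.expo l) (X.field s t p) = 0 := fun t =>
    Φ.field_comp_eq_zero s (fun _ => Φ.field_annMode_comm s X hcX _ _) hq hN
  have h2 : ∀ t, Φ.field s (x.1 - Φ.expo l) (Y.field s t p) = 0 := fun t =>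
    Φ.field_comp_eq_zero s (fun _ => Φ.field_annMode_comm s Y hcY _ _) hq hN
  have h3 : ∀ t u, Φ.field s (x.1 - Φ.expo l) (X.field s t (Y.field s u p)) = 0 := fun t u =>
    Φ.field_comp_eq_zero s (T := X.field s t * Y.field s u) (fun _ =>
      (Φ.field_annMode_comm s X hcX _ _).mul_right (Φ.field_annMode_comm s Y hcY _ _)) hq hN
  have h4 : ∀ t u, Φ.field s (x.1 - Φ.expo l) (Y.field s t (X.field s u p)) = 0 := fun t u =>
    Φ.field_comp_eq_zero s (T := Y.field s t * X.field s u) (fun _ =>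
      (Φ.field_annMode_comm s Y hcY _ _).mul_right (Φ.field_annMode_comm s X hcX _ _)) hq hN
  simp only [symSerre, serre, LinearMap.add_apply, LinearMap.sub_apply, LinearMap.smul_apply,
    Module.End.mul_apply, mode_single, map_smul, heX, heY, h0, h1, h2, h3, h4, smul_zero,
    Finsupp.single_zero, map_zero, sub_zero, add_zero]

theorem field_field_eq_zero (s : K) (X Y : VertexData K n) {t u : ℚ} {N : ℤ}
    (h : N + t + u < 0) {p : Osc K n} (hp : p ∈ levelLE K n N) :
    X.field s t (Y.field s u p) = 0 := by
  refine X.field_eq_zero s ?_ (Y.field_levelLE s u hp)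
  have := Int.floor_le ((N : ℚ) + u)
  linarith

/-- After Y the level is at most N + u, and X kills all vectors of that level. As X commutes with
the creation part of Φ, inserting Φ between them does not weaken this bound. -/
theorem field_field_field_eq_zero [CharZero K] (s : K) (Φ X Y : VertexData K n)
    (hcX : ∀ k : ℕ, k * X.contraction s Φ k = 0) (q : ℚ) {t u : ℚ} {N : ℤ} (h : N + t + u < 0)
    {p : Osc K n} (hp : p ∈ levelLE K n N) :
    X.field s t (Φ.field s q (Y.field s u p)) = 0 := by
  refine Φ.comp_field_eq_zero s (fun _ => X.field_creMode_comm s Φ hcX _ _)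
    (fun p' hp' => X.field_eq_zero s ?_ hp') q (Y.field_levelLE s u hp)
  have := Int.floor_le ((N : ℚ) + u)
  linarith

theorem field_comp_field_eq_zero [CharZero K] (s : K) (Φ X Y : VertexData K n)
    (hcX : ∀ k : ℕ, k * X.contraction s Φ k = 0) (hcY : ∀ k : ℕ, k * Y.contraction s Φ k = 0)
    (q : ℚ) {t u : ℚ} {N : ℤ} (h : N + t + u < 0) {p : Osc K n} (hp : p ∈ levelLE K n N) :
    X.field s t (Y.field s u (Φ.field s q p)) = 0 :=
  Φ.comp_field_eq_zero s (T := X.field s t * Y.field s u) (fun _ =>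
    (X.field_creMode_comm s Φ hcX _ _).mul_left (Y.field_creMode_comm s Φ hcY _ _))
    (fun _ hp' => field_field_eq_zero s X Y h hp') q hp

/-- The case of Φ_-. Here the index of Φ is not controlled, but the sum of the indices of X and Y
is: each term vanishes once that sum is small, wherever Φ stands. Both shifts lower this sum by one.
-/
theorem symSerre_mode_eq_zero' [CharZero K] (s : K) {Φ X Y : VertexData K n} {a b : K}
    (ha : a ≠ 0)
    (hX : ∀ r t, Φ.mode s r * X.mode s t - (a * b) • (Φ.mode s (r + 1) * X.mode s (t - 1)) =
      a • (X.mode s t * Φ.mode s r) - b • (X.mode s (t - 1) * Φ.mode s (r + 1)))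
    (hY : ∀ r t, Φ.mode s r * Y.mode s t - (a * b) • (Φ.mode s (r + 1) * Y.mode s (t - 1)) =
      a • (Y.mode s t * Φ.mode s r) - b • (Y.mode s (t - 1) * Φ.mode s (r + 1)))
    (hXY : ∀ t u, X.mode s t * Y.mode s u -
        (a ^ 2)⁻¹ • (X.mode s (t + 1) * Y.mode s (u - 1)) =
      (a ^ 2)⁻¹ • (Y.mode s u * X.mode s t) - Y.mode s (u - 1) * X.mode s (t + 1))
    (hcX : ∀ k : ℕ, k * X.contraction s Φ k = 0) (hcY : ∀ k : ℕ, k * Y.contraction s Φ k = 0)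
    (heX : ∀ l, X.expo (l + Φ.shift) = X.expo l) (heY : ∀ l, Y.expo (l + Φ.shift) = Y.expo l)
    (heXY : ∀ l, X.expo (l + Y.shift) = X.expo l) (heYX : ∀ l, Y.expo (l + X.shift) = Y.expo l)
    (x : ℚ × ℚ × ℚ) : symSerre a (Φ.mode s) (X.mode s) (Y.mode s) x = 0 := by
  refine Finsupp.lhom_ext fun l p => ?_
  obtain ⟨N, hN⟩ := exists_levelLE p
  have hkey := symSerre_exchange_op (R := Module.End K (Fock K n)) ha hX hY hXY
  rw [LinearMap.zero_apply]
  refine eq_zero_of_shift_eq (β := a * b) (d := (1, -1, 0)) (e := (1, 0, -1))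
    (f := fun x => symSerre a (Φ.mode s) (X.mode s) (Y.mode s) x (Finsupp.single l p))
    (fun x => DFunLike.congr_fun (hkey x) (Finsupp.single l p))
    ((AddMonoidHom.fst ℚ ℚ + AddMonoidHom.snd ℚ ℚ).comp (AddMonoidHom.snd ℚ (ℚ × ℚ)))
    (by simp) (by simp) (B := X.expo l + Y.expo l - N) (fun x hx => ?_) x
  have hx' : x.2.1 + x.2.2 < X.expo l + Y.expo l - N := hx
  have hq : (N : ℚ) + (x.2.1 - X.expo l) + (x.2.2 - Y.expo l) < 0 := by linarith
  have hq' : (N : ℚ) + (x.2.2 - Y.expo l) + (x.2.1 - X.expo l) < 0 := by linarith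
  have h1 := field_field_eq_zero s X Y hq hN
  have h2 := field_field_eq_zero s Y X hq' hN
  have h3 := fun q => field_field_field_eq_zero s Φ X Y hcX q hq hN
  have h4 := fun q => field_field_field_eq_zero s Φ Y X hcY q hq' hN
  have h5 := fun q => field_comp_field_eq_zero s Φ X Y hcX hcY q hq hN
  have h6 := fun q => field_comp_field_eq_zero s Φ Y X hcY hcX q hq' hN
  simp only [symSerre, serre, LinearMap.add_apply, LinearMap.sub_apply, LinearMap.smul_apply,
    Module.End.mul_apply, mode_single, map_smul, heX, heY, heXY, heYX, h1, h2, h3, h4, h5, h6,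
    smul_zero, Finsupp.single_zero, map_zero, sub_zero, add_zero]

end VertexData

/-! ## The currents of `U_q(C_n^{(1)})` -/

theorem zpow_ne_one_of_pow_ne_one {s : K} (hs : ∀ m : ℕ, 0 < m → s ^ m ≠ 1) {m : ℤ}
    (hm : m ≠ 0) : s ^ m ≠ 1 := by
  rcases Int.natAbs_eq m with h | h
  · rw [h, zpow_natCast]
    exact hs _ (Int.natAbs_pos.mpr hm)
  · rw [h, zpow_neg, zpow_natCast, inv_ne_one]
    exact hs _ (Int.natAbs_pos.mpr hm)

theorem zpow_sub_zpow_neg_ne_zero {s : K} (hs0 : s ≠ 0) (hs : ∀ m : ℕ, 0 < m → s ^ m ≠ 1) {m : ℤ}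
    (hm : m ≠ 0) : s ^ m - s ^ (-m) ≠ 0 := by
  intro h
  refine zpow_ne_one_of_pow_ne_one hs (m := m + m) (by omega) ?_
  rw [zpow_add₀ hs0]
  nth_rewrite 2 [sub_eq_zero.mp h]
  rw [← zpow_add₀ hs0, add_neg_cancel, zpow_zero]

theorem zpow_add_zpow_neg_ne_zero {s : K} (hs0 : s ≠ 0) (hs : ∀ m : ℕ, 0 < m → s ^ m ≠ 1) {m : ℤ}
    (hm : m ≠ 0) : s ^ m + s ^ (-m) ≠ 0 := by
  intro h
  refine zpow_sub_zpow_neg_ne_zero hs0 hs (m := m + m) (by omega) ?_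
  rw [neg_add, zpow_add₀ hs0, zpow_add₀ hs0]
  linear_combination (s ^ m - s ^ (-m)) * h

theorem qHalf_ne_zero {s : K} (hs0 : s ≠ 0) (hs : ∀ m : ℕ, 0 < m → s ^ m ≠ 1) {m : ℤ}
    (hm : m ≠ 0) : qHalf s m ≠ 0 :=
  div_ne_zero (zpow_sub_zpow_neg_ne_zero hs0 hs (by omega))
    (zpow_sub_zpow_neg_ne_zero hs0 hs (by norm_num))

theorem qHalf_neg (s : K) (m : ℤ) : qHalf s (-m) = -qHalf s m := by
  rw [qHalf, qHalf, mul_neg, neg_neg, ← neg_div, neg_sub]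

theorem qHalf_mul_two {s : K} (hs0 : s ≠ 0) (m : ℤ) :
    qHalf s (m * 2) = qHalf s m * (s ^ (2 * m) + s ^ (-(2 * m))) := by
  have h1 : 2 * (m * 2) = 2 * m + 2 * m := by ring
  rw [qHalf, qHalf, h1, neg_add, zpow_add₀ hs0, zpow_add₀ hs0]
  ring

/-! ### The lattice -/

theorem dot_eps (i : Fin n) (x : Fin n → ℤ) : dot (eps i) x = x i := by
  simp [dot, eps, Pi.single_apply]

theorem dot_comm (x y : Fin n → ℤ) : dot x y = dot y x := by
  simp [dot, mul_comm]

theorem root_zero (hn : 2 ≤ n) :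
    root (⟨0, by omega⟩ : Fin n) = eps ⟨0, by omega⟩ - eps ⟨1, by omega⟩ := by
  rw [root, dif_pos (by simp; omega)]

theorem dot_root_zero (hn : 2 ≤ n) (x : Fin n → ℤ) :
    dot (root ⟨0, by omega⟩) x = x ⟨0, by omega⟩ - x ⟨1, by omega⟩ := by
  rw [root_zero hn, ← dot_eps _ x, ← dot_eps _ x]
  simp [dot, sub_mul]

/-- For n = 2 the neighbour of α_1 is the long root, which is why the value −2 occurs. -/
theorem dot_root_zero_root (hn : 2 ≤ n) (i : Fin n) :
    dot (root ⟨0, by omega⟩) (root i) =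
      if i.val = 0 then 2 else if i.val = 1 then (if 2 < n then -1 else -2) else 0 := by
  obtain ⟨i, hi⟩ := i
  rw [dot_root_zero hn, root]
  rcases i with _ | _ | i
  · rw [dif_pos (by simp; omega)]
    simp [eps]
  · by_cases h : 2 < n
    · rw [dif_pos (by simpa using h)]
      simp [eps, h]
    · rw [dif_neg (by simpa using h)]
      simp [eps, h]
  · split_ifs <;> simp_all [eps]

/-! ### The dual boson -/

theorem aComm_comm (s : K) (i j : Fin n) (m : ℤ) : aComm s i j m = aComm s j i m := by
  rw [aComm, aComm, dot_comm]

theorem aBarCoeff_neg (s : K) (i : Fin n) (k : ℤ) : aBarCoeff s i (-k) = -aBarCoeff s i k := by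
  simp only [aBarCoeff, qHalf_neg, mul_neg, neg_neg, neg_sq, Int.cast_neg, neg_div, neg_mul]
  rw [add_comm (s ^ (2 * ((n : ℤ) + 1) * k)), add_comm (s ^ (2 * ((n : ℤ) - (i : ℕ)) * k))]

/-- Only α_1 and α_2 pair with α_1. With C_m = q^{mk/2} + q^{−mk/2}, the sum reduces to C_1 C_n −
C_{n−1} = C_{n+1}. For n = 2 the coefficient of the last boson lacks the factor C_1, but [−k] =
−[k/2] C_1 supplies it. The value is −1 and not 1 because the coefficient is taken at k instead of
−k, and it is odd in k. -/
theorem sum_aComm_mul_aBarCoeff [CharZero K] {s : K} (hs0 : s ≠ 0)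
    (hs : ∀ m : ℕ, 0 < m → s ^ m ≠ 1) (hn : 2 ≤ n) {k : ℤ} (hk : k ≠ 0) :
    ∑ i, aComm s (⟨0, by omega⟩ : Fin n) i k * aBarCoeff s i k = -1 := by
  have hq := qHalf_ne_zero hs0 hs hk
  have hkK : (k : K) ≠ 0 := by exact_mod_cast hk
  have hC : s ^ (2 * ((n : ℤ) + 1) * k) + s ^ (-(2 * ((n : ℤ) + 1) * k)) ≠ 0 :=
    zpow_add_zpow_neg_ne_zero hs0 hs (mul_ne_zero (by omega) hk)
  have hsum : ∑ i, aComm s (⟨0, by omega⟩ : Fin n) i k * aBarCoeff s i k =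
      aComm s (⟨0, by omega⟩ : Fin n) ⟨0, by omega⟩ k * aBarCoeff s (⟨0, by omega⟩ : Fin n) k +
        aComm s (⟨0, by omega⟩ : Fin n) ⟨1, by omega⟩ k * aBarCoeff s (⟨1, by omega⟩ : Fin n) k := by
    refine Finset.sum_eq_add _ _ (by simp) (fun i _ hi => ?_) (by simp) (by simp)
    have h0 : i.val ≠ 0 := fun h => hi.1 (Fin.ext h)
    have h1 : i.val ≠ 1 := fun h => hi.2 (Fin.ext h)
    rw [aComm, dot_root_zero_root hn, if_neg h0, if_neg h1]
    simp [qHalf]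
  rw [hsum]
  simp only [aComm, dot_root_zero_root hn, aBarCoeff, if_true, one_ne_zero, if_false, zero_add,
    Nat.cast_zero, Nat.cast_one, sub_zero, qHalf_neg, qHalf_mul_two hs0]
  rw [if_pos (by omega)]
  set x := s ^ (2 * k) with hx
  have hx0 : x ≠ 0 := zpow_ne_zero _ hs0
  simp only [zpow_neg, ← hx] at hC ⊢
  have e1 : s ^ (2 * ((n : ℤ) + 1) * k) = s ^ (2 * (n : ℤ) * k) * x := by
    rw [hx, ← zpow_add₀ hs0]; ring_nf
  have hy0 : s ^ (2 * (n : ℤ) * k) ≠ 0 := zpow_ne_zero _ hs0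
  rw [e1] at hC ⊢
  by_cases h : 2 < n
  · have e2 : s ^ (2 * ((n : ℤ) - 1) * k) = s ^ (2 * (n : ℤ) * k) * x⁻¹ := by
      rw [hx, ← zpow_neg, ← zpow_add₀ hs0]; ring_nf
    rw [if_pos h, if_pos (by omega), mul_neg_one, qHalf_neg, e2]
    set y := s ^ (2 * (n : ℤ) * k)
    have hC' : x ^ 2 * y ^ 2 + 1 ≠ 0 := fun h0 => hC (by field_simp; linear_combination h0)
    field_simp
    ring
  · obtain rfl : n = 2 := by omega
    have e2 : s ^ (2 * ((2 : ℕ) : ℤ) * k) = x ^ 2 := by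
      rw [hx, ← zpow_natCast, ← zpow_mul]; congr 1; push_cast; ring
    have e3 : k * (-2) = -(k * 2) := by ring
    rw [if_neg h, if_neg (by omega), e3, qHalf_neg, qHalf_mul_two hs0, zpow_neg, ← hx]
    rw [e2] at hC ⊢
    have hC' : x ^ 6 + 1 ≠ 0 := fun h0 => hC (by field_simp; linear_combination h0)
    field_simp
    ring

/-! ### Contractions -/

open VertexData

theorem single_fun_apply (i j : Fin n) (f : ℕ → K) (k : ℕ) :
    (Pi.single i f : Fin n → ℕ → K) j k = if j = i then f k else 0 := by
  rw [Pi.single_apply]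
  split_ifs <;> rfl

/-- The factor Y contributes 1 + q^{−k}. The contraction of Z_1^- with itself contributes −1, so the
pole at equal arguments disappears and only the one at ratio q^{−1} stays. Z_2^+ gives the
numerator. -/
theorem contraction_XMinusPart [CharZero K] {s : K} (hs0 : s ≠ 0)
    (hs : ∀ m : ℕ, 0 < m → s ^ m ≠ 1) (hn : 2 ≤ n) (ε ε' : ℤ) (k : ℕ) :
    k * (XMinusPart (n := n) s 0 (by omega) ε).contraction s (XMinusPart s 0 (by omega) ε') k =
      (((s ^ 2) ^ 2)⁻¹) ^ k - (s ^ (2 * ε') / s ^ (2 * ε)) ^ k := by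
  rcases Nat.eq_zero_or_pos k with rfl | hk
  · simp
  have hkK : (k : K) ≠ 0 := by exact_mod_cast hk.ne'
  have hq := qHalf_ne_zero hs0 hs (m := k) (by omega)
  have h2 : dot (root (⟨0, by omega⟩ : Fin n)) (root ⟨0, by omega⟩) = 2 := by
    rw [dot_root_zero_root hn, if_pos rfl]
  simp only [contraction, XMinusPart, normalProd, Z, Y, Pi.add_apply,
    single_fun_apply, zero_add, add_zero, mul_ite, ite_mul, mul_zero, zero_mul, add_mul, mul_add,
    Finset.sum_add_distrib, Finset.sum_ite_eq', Finset.mem_univ, if_true,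
    Fin.mk.injEq, zero_ne_one, one_ne_zero, if_false, aComm, h2,
    qHalf_mul_two hs0, qHalf_neg]
  have e1 : s ^ (-1 * (k : ℤ)) = (s ^ k)⁻¹ := by rw [neg_one_mul, zpow_neg, zpow_natCast]
  have e2 : s ^ (2 * (k : ℤ)) = (s ^ k) ^ 2 := by
    rw [mul_comm, zpow_mul, zpow_natCast]; norm_cast
  have e3 : ((((s ^ 2) ^ 2)⁻¹) ^ k : K) = ((s ^ k) ^ 4)⁻¹ := by
    rw [inv_pow, ← pow_mul, ← pow_mul, ← pow_mul]; ring_nf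
  rw [zpow_neg, e1, e2, e3, div_pow]
  have h0 : s ^ k ≠ 0 := pow_ne_zero _ hs0
  have h1 : (s ^ (2 * ε)) ^ k ≠ 0 := pow_ne_zero _ (zpow_ne_zero _ hs0)
  push_cast
  simp only [one_pow, inv_one, mul_one]
  field_simp
  ring

/-- The `b` bosons give the first power and the dual boson the second; the latter meets only the a_1
in Y. At δ = 1 the two cancel. -/
theorem contraction_PhiPart_XMinusPart [CharZero K] {s : K} (hs0 : s ≠ 0)
    (hs : ∀ m : ℕ, 0 < m → s ^ m ≠ 1) (hn : 2 ≤ n) (c : K) (κ : ℚ) (δ ε : ℤ) (k : ℕ) :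
    k * (PhiPart s hn c κ δ).contraction s (XMinusPart s 0 (by omega) ε) k =
      ((s ^ (4 * n + 2 + 2 * δ))⁻¹) ^ k - ((s ^ (4 * n + 4))⁻¹) ^ k := by
  rcases Nat.eq_zero_or_pos k with rfl | hk
  · simp
  have hkK : (k : K) ≠ 0 := by exact_mod_cast hk.ne'
  have hq := qHalf_ne_zero hs0 hs (m := k) (by omega)
  have hbar := sum_aComm_mul_aBarCoeff hs0 hs hn (k := k) (by omega)
  simp only [contraction, XMinusPart, PhiPart, PhiA, normalProd, Z, Y, Pi.add_apply,
   
    single_fun_apply, zero_add, add_zero, mul_ite, ite_mul, mul_zero, zero_mul, add_mul, mul_add,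
    Finset.sum_add_distrib, Finset.sum_ite_eq', Finset.mem_univ, if_true,
    Fin.mk.injEq, one_ne_zero, if_false,
    qHalf_neg]
  have hsum : ∀ A B : K, ∑ i : Fin n, A * aBarCoeff s i k * aComm s i ⟨0, by omega⟩ k * B =
      -(A * B) := fun A B => by
    rw [← mul_neg_one (A * B), ← hbar, Finset.mul_sum]
    refine Finset.sum_congr rfl fun i _ => ?_
    rw [aComm_comm s i]
    ring
  rw [hsum]
  have e1 : s ^ (-1 * (k : ℤ)) = (s ^ k)⁻¹ := by rw [neg_one_mul, zpow_neg, zpow_natCast]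
  have e2 : s ^ (4 * n * k + 3 * k) * s ^ k = (s ^ (4 * n + 4)) ^ k := by
    rw [← pow_add, ← pow_mul]; ring_nf
  rw [e1, inv_pow, inv_pow, ← e2]
  have h0 : s ^ k ≠ 0 := pow_ne_zero _ hs0
  have h1 : s ^ (4 * n * k + 3 * k) ≠ 0 := pow_ne_zero _ hs0
  have h2 : (s ^ (4 * (n : ℤ) + 2 + 2 * δ)) ^ k ≠ 0 := pow_ne_zero _ (zpow_ne_zero _ hs0)
  push_cast
  simp only [one_pow, mul_one]
  field_simp
  ring

/-- As in the opposite order, the first power comes from the `b` bosons and the second from the dual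
boson, but now the cancellation occurs at δ = −1. -/
theorem contraction_XMinusPart_PhiPart [CharZero K] {s : K} (hs0 : s ≠ 0)
    (hs : ∀ m : ℕ, 0 < m → s ^ m ≠ 1) (hn : 2 ≤ n) (c : K) (κ : ℚ) (δ ε : ℤ) (k : ℕ) :
    k * (XMinusPart s 0 (by omega) ε).contraction s (PhiPart s hn c κ δ) k =
      (s ^ (4 * n + 2 + 2 * δ)) ^ k - (s ^ (4 * n)) ^ k := by
  rcases Nat.eq_zero_or_pos k with rfl | hk
  · simp
  have hkK : (k : K) ≠ 0 := by exact_mod_cast hk.ne'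
  have hq := qHalf_ne_zero hs0 hs (m := k) (by omega)
  have hbar := sum_aComm_mul_aBarCoeff hs0 hs hn (k := k) (by omega)
  simp only [contraction, XMinusPart, PhiPart, PhiA, normalProd, Z, Y, Pi.add_apply,
   
    single_fun_apply, zero_add, add_zero, mul_ite, ite_mul, mul_zero, zero_mul, add_mul, mul_add,
    Finset.sum_ite_eq', Finset.mem_univ, if_true,
    Fin.mk.injEq, zero_ne_one, if_false,
    qHalf_neg]
  have hsum : ∀ A B : K, ∑ i : Fin n, ∑ j : Fin n, (if i = ⟨0, by omega⟩ then
      A * aComm s i j k * (B * aBarCoeff s j (-(k : ℤ))) else 0) = A * B := fun A B => by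
    rw [Finset.sum_comm]
    simp only [Finset.sum_ite_eq', Finset.mem_univ, if_true, aBarCoeff_neg]
    rw [← neg_neg (A * B), ← mul_neg_one (A * B), ← hbar, Finset.mul_sum, ← Finset.sum_neg_distrib]
    refine Finset.sum_congr rfl fun i _ => ?_
    ring
  rw [hsum]
  have e1 : s ^ (-1 * (k : ℤ)) = (s ^ k)⁻¹ := by rw [neg_one_mul, zpow_neg, zpow_natCast]
  have e2 : s ^ (4 * n * k + 1 * k) = (s ^ (4 * n)) ^ k * s ^ k := by
    rw [← pow_mul, ← pow_add]; ring_nf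
  rw [e1, e2]
  have h0 : s ^ k ≠ 0 := pow_ne_zero _ hs0
  push_cast
  simp only [one_pow, inv_one, mul_one]
  field_simp
  ring

/-! ### Zero modes of the currents -/

theorem ofP_coe (x : Fin n → ℤ) : ((ofP x : HalfLattice n) : Fin n → ℤ) = 2 • x := rfl

theorem XMinusPart_expo (s : K) (hn : 2 ≤ n) (ε : ℤ) (l : Sector n) :
    (XMinusPart s 0 (by omega) ε).expo l = -(l.2 ⟨0, by omega⟩ : ℚ) + l.2 ⟨1, by omega⟩ +
      ((l.1.1 ⟨0, by omega⟩ - l.1.1 ⟨1, by omega⟩ : ℤ) : ℚ) / 2 := by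
  simp only [XMinusPart, normalProd, Z, Y, Pi.add_apply, dot_eps, dot_root_zero hn]
  push_cast
  ring

theorem XMinusPart_scal (s : K) (hn : 2 ≤ n) (ε : ℤ) (l : Sector n) :
    (XMinusPart s 0 (by omega) ε).scal l = (s ^ (2 * ε)) ^ l.2 ⟨1, by omega⟩ := by
  simp [XMinusPart, normalProd, Z, Y, dot_eps]

theorem XMinusPart_shift (s : K) (hn : 2 ≤ n) (ε : ℤ) :
    (XMinusPart (n := n) s 0 (by omega) ε).shift =
      (ofP (-root ⟨0, by omega⟩), -eps ⟨0, by omega⟩ + eps ⟨1, by omega⟩) := by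
  simp [XMinusPart, normalProd, Z, Y]

theorem PhiPart_expo (s : K) (hn : 2 ≤ n) (c : K) (κ : ℚ) (δ : ℤ) (l : Sector n) :
    (PhiPart s hn c κ δ).expo l =
      -((l.1.1 ⟨0, by omega⟩ : ℚ) / 2) + κ + l.2 ⟨0, by omega⟩ := by
  simp [PhiPart, PhiA, normalProd, Z, dot_eps]

theorem PhiPart_scal (s : K) (hn : 2 ≤ n) (c : K) (κ : ℚ) (δ : ℤ) (l : Sector n) :
    (PhiPart s hn c κ δ).scal l = c * s ^ (-((2 * n + 1) * l.1.1 ⟨0, by omega⟩)) *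
      (s ^ (4 * n + 2 + 2 * δ)) ^ l.2 ⟨0, by omega⟩ := by
  simp [PhiPart, PhiA, normalProd, Z, dot_eps]

theorem PhiPart_shift (s : K) (hn : 2 ≤ n) (c : K) (κ : ℚ) (δ : ℤ) :
    (PhiPart s hn c κ δ).shift = (ofP (eps ⟨0, by omega⟩), eps ⟨0, by omega⟩) := by
  simp [PhiPart, PhiA, normalProd, Z]

/-- The power of z contributed by the lattice of the `a` bosons cancels that of the `b` bosons, so
only a scalar from the label β_2 survives. The same cancellation makes the currents and Φ_δ local in
both orders. -/
theorem zeroModeLocal_XMinusPart {s : K} (hs0 : s ≠ 0) (hn : 2 ≤ n) (ε ε' : ℤ) :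
    ZeroModeLocal (XMinusPart (n := n) s 0 (by omega) ε) (XMinusPart s 0 (by omega) ε')
      (s ^ (2 * ε)) where
  expo_eq l := by
    rw [XMinusPart_expo s hn, XMinusPart_expo s hn, XMinusPart_shift s hn]
    simp [ofP_coe, root_zero hn, eps]
    ring
  scal_eq l := by
    rw [XMinusPart_scal s hn, XMinusPart_scal s hn, XMinusPart_shift s hn]
    simp [eps]
    rw [zpow_add₀ (zpow_ne_zero _ hs0), zpow_one, mul_comm]

theorem zeroModeLocal_XMinusPart_PhiPart (s : K) (hn : 2 ≤ n) (c : K) (κ : ℚ) (δ ε : ℤ) :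
    ZeroModeLocal (XMinusPart s 0 (by omega) ε) (PhiPart s hn c κ δ) 1 where
  expo_eq l := by
    rw [XMinusPart_expo s hn, XMinusPart_expo s hn, PhiPart_shift s hn]
    simp [ofP_coe, eps]
    ring
  scal_eq l := by
    rw [XMinusPart_scal s hn, XMinusPart_scal s hn, PhiPart_shift s hn]
    simp [eps]

theorem zeroModeLocal_PhiPart_XMinusPart {s : K} (hs0 : s ≠ 0) (hn : 2 ≤ n) (c : K) (κ : ℚ)
    (δ ε : ℤ) :
    ZeroModeLocal (PhiPart s hn c κ δ) (XMinusPart s 0 (by omega) ε) (s ^ (-(2 * δ))) where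
  expo_eq l := by
    rw [PhiPart_expo s hn, PhiPart_expo s hn, XMinusPart_shift s hn]
    simp [ofP_coe, root_zero hn, eps]
    ring
  scal_eq l := by
    rw [PhiPart_scal s hn, PhiPart_scal s hn, XMinusPart_shift s hn]
    -- The shift by −α_1 acts through −λ_1(0) and lowers β_1 by one. The resulting powers of
    -- q^{n+1/2} cancel, and only the displacement by δ remains.
    have h : s ^ (-(2 * δ)) = s ^ ((2 * n + 1) * (2 : ℤ)) * (s ^ (4 * n + 2 + 2 * δ))⁻¹ := by
      rw [← zpow_neg, ← zpow_add₀ hs0]; ring_nf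
    have e0 : ((l + (ofP (-root ⟨0, by omega⟩), -eps ⟨0, by omega⟩ + eps ⟨1, by omega⟩)).1.1
        (⟨0, by omega⟩ : Fin n)) = l.1.1 ⟨0, by omega⟩ - 2 := by
      simp [ofP_coe, root_zero hn, eps]; ring
    have e1 : ((l + (ofP (-root ⟨0, by omega⟩), -eps ⟨0, by omega⟩ + eps ⟨1, by omega⟩)).2
        (⟨0, by omega⟩ : Fin n)) = l.2 ⟨0, by omega⟩ - 1 := by
      simp [eps]; ring
    rw [e0, e1, h, zpow_sub₀ (zpow_ne_zero _ hs0), zpow_one, mul_sub, neg_sub, sub_eq_add_neg,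
      zpow_add₀ hs0]
    ring

/-! ### The Serre relation -/

theorem XMinusPart_exchange [CharZero K] {s : K} (hs0 : s ≠ 0)
    (hs : ∀ m : ℕ, 0 < m → s ^ m ≠ 1) (hn : 2 ≤ n) (ε ε' : ℤ) (t u : ℚ) :
    (XMinusPart (n := n) s 0 (by omega) ε).mode s t * (XMinusPart s 0 (by omega) ε').mode s u -
        ((s ^ 2) ^ 2)⁻¹ • ((XMinusPart s 0 (by omega) ε).mode s (t + 1) *
          (XMinusPart s 0 (by omega) ε').mode s (u - 1)) =
      ((s ^ 2) ^ 2)⁻¹ • ((XMinusPart s 0 (by omega) ε').mode s u *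
          (XMinusPart s 0 (by omega) ε).mode s t) -
        (XMinusPart s 0 (by omega) ε').mode s (u - 1) *
          (XMinusPart s 0 (by omega) ε).mode s (t + 1) :=
  mode_exchange_of_pole s (zeroModeLocal_XMinusPart hs0 hn ε ε')
    (zeroModeLocal_XMinusPart hs0 hn ε' ε) (contraction_XMinusPart hs0 hs hn ε ε')
    (contraction_XMinusPart hs0 hs hn ε' ε) (mul_div_cancel₀ _ (zpow_ne_zero _ hs0))
    (mul_div_cancel₀ _ (zpow_ne_zero _ hs0)) t u

theorem contraction_PhiPart_one [CharZero K] {s : K} (hs0 : s ≠ 0)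
    (hs : ∀ m : ℕ, 0 < m → s ^ m ≠ 1) (hn : 2 ≤ n) (c : K) (κ : ℚ) (ε : ℤ) (k : ℕ) :
    k * (PhiPart s hn c κ 1).contraction s (XMinusPart s 0 (by omega) ε) k = 0 := by
  have e : s ^ (4 * (n : ℤ) + 2 + 2 * 1) = s ^ (4 * n + 4) := by
    rw [← zpow_natCast]; congr 1
  rw [contraction_PhiPart_XMinusPart hs0 hs hn, e, sub_self]

theorem contraction_XMinusPart_neg_one [CharZero K] {s : K} (hs0 : s ≠ 0)
    (hs : ∀ m : ℕ, 0 < m → s ^ m ≠ 1) (hn : 2 ≤ n) (c : K) (κ : ℚ) (ε : ℤ) (k : ℕ) :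
    k * (XMinusPart s 0 (by omega) ε).contraction s (PhiPart s hn c κ (-1)) k = 0 := by
  have e : s ^ (4 * (n : ℤ) + 2 + 2 * -1) = s ^ (4 * n) := by
    rw [← zpow_natCast]; congr 1; push_cast; ring
  rw [contraction_XMinusPart_PhiPart hs0 hs hn, e, sub_self]

/-- The relation required in `symSerre_exchange` with a = s² and b = s^{4n+2}: the pole is ab, the
contraction zero is a⁻¹b, and a compensates the zero mode scalar s^{−2}. -/
theorem XMinusPart_PhiPart_exchange [CharZero K] {s : K} (hs0 : s ≠ 0)
    (hs : ∀ m : ℕ, 0 < m → s ^ m ≠ 1) (hn : 2 ≤ n) (c : K) (κ : ℚ) (ε : ℤ) (r t : ℚ) :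
    (XMinusPart s 0 (by omega) ε).mode s t * (PhiPart s hn c κ 1).mode s r -
        (s ^ 2 * s ^ (4 * n + 2)) • ((XMinusPart s 0 (by omega) ε).mode s (t + 1) *
          (PhiPart s hn c κ 1).mode s (r - 1)) =
      s ^ 2 • ((PhiPart s hn c κ 1).mode s r * (XMinusPart s 0 (by omega) ε).mode s t) -
        s ^ (4 * n + 2) • ((PhiPart s hn c κ 1).mode s (r - 1) *
          (XMinusPart s 0 (by omega) ε).mode s (t + 1)) := by
  have hβ : s ^ (4 * (n : ℤ) + 2 + 2 * 1) = s ^ 2 * s ^ (4 * n + 2) := by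
    rw [← pow_add, ← zpow_natCast]; congr 1; push_cast; ring
  have hα : s ^ 2 * s ^ (4 * n) = s ^ (4 * n + 2) := by ring
  have hρ : s ^ 2 * s ^ (-(2 * 1) : ℤ) = 1 := by
    rw [← zpow_natCast, ← zpow_add₀ hs0]; simp
  rw [mode_exchange_of_no_pole s (zeroModeLocal_XMinusPart_PhiPart s hn c κ 1 ε)
    (zeroModeLocal_PhiPart_XMinusPart hs0 hn c κ 1 ε)
    (fun k => by rw [contraction_XMinusPart_PhiPart hs0 hs hn, hβ])
    (contraction_PhiPart_one hs0 hs hn c κ ε) hρ, hα]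

/-- The mirror relation, with the same a and the inverse b = s^{−(4n+2)}. -/
theorem PhiPart_XMinusPart_exchange [CharZero K] {s : K} (hs0 : s ≠ 0)
    (hs : ∀ m : ℕ, 0 < m → s ^ m ≠ 1) (hn : 2 ≤ n) (c : K) (κ : ℚ) (ε : ℤ) (r t : ℚ) :
    (PhiPart s hn c κ (-1)).mode s r * (XMinusPart s 0 (by omega) ε).mode s t -
        (s ^ 2 * (s ^ (4 * n + 2))⁻¹) • ((PhiPart s hn c κ (-1)).mode s (r + 1) *
          (XMinusPart s 0 (by omega) ε).mode s (t - 1)) =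
      s ^ 2 • ((XMinusPart s 0 (by omega) ε).mode s t * (PhiPart s hn c κ (-1)).mode s r) -
        (s ^ (4 * n + 2))⁻¹ • ((XMinusPart s 0 (by omega) ε).mode s (t - 1) *
          (PhiPart s hn c κ (-1)).mode s (r + 1)) := by
  have hβ : (s ^ (4 * (n : ℤ) + 2 + 2 * -1))⁻¹ = s ^ 2 * (s ^ (4 * n + 2))⁻¹ := by
    have e : s ^ (4 * (n : ℤ) + 2 + 2 * -1) = s ^ (4 * n) := by
      rw [← zpow_natCast]; congr 1; push_cast; ring
    rw [e, pow_add]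
    field_simp
  have hα : s ^ 2 * (s ^ (4 * n + 4))⁻¹ = (s ^ (4 * n + 2))⁻¹ := by
    rw [pow_add, pow_add]
    field_simp
  have hρ : s ^ 2 * 1 = s ^ (-(2 * -1) : ℤ) := by
    rw [mul_one, ← zpow_natCast]; simp
  rw [mode_exchange_of_no_pole s (zeroModeLocal_PhiPart_XMinusPart hs0 hn c κ (-1) ε)
    (zeroModeLocal_XMinusPart_PhiPart s hn c κ (-1) ε)
    (fun k => by rw [contraction_PhiPart_XMinusPart hs0 hs hn, hβ])
    (contraction_XMinusPart_neg_one hs0 hs hn c κ ε) hρ, hα]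

theorem symSerre_PhiPart_one [CharZero K] {s : K} (hs0 : s ≠ 0)
    (hs : ∀ m : ℕ, 0 < m → s ^ m ≠ 1) (hn : 2 ≤ n) (c : K) (κ : ℚ) (ε ε' : ℤ) (x : ℚ × ℚ × ℚ) :
    symSerre (s ^ 2) ((PhiPart s hn c κ 1).mode s) ((XMinusPart s 0 (by omega) ε).mode s)
      ((XMinusPart s 0 (by omega) ε').mode s) x = 0 :=
  symSerre_mode_eq_zero s (pow_ne_zero 2 hs0) (XMinusPart_PhiPart_exchange hs0 hs hn c κ ε)
    (XMinusPart_PhiPart_exchange hs0 hs hn c κ ε') (XMinusPart_exchange hs0 hs hn ε ε')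
    (contraction_PhiPart_one hs0 hs hn c κ ε) (contraction_PhiPart_one hs0 hs hn c κ ε')
    (zeroModeLocal_PhiPart_XMinusPart hs0 hn c κ 1 ε).expo_eq
    (zeroModeLocal_PhiPart_XMinusPart hs0 hn c κ 1 ε').expo_eq x

theorem symSerre_PhiPart_neg_one [CharZero K] {s : K} (hs0 : s ≠ 0)
    (hs : ∀ m : ℕ, 0 < m → s ^ m ≠ 1) (hn : 2 ≤ n) (c : K) (κ : ℚ) (ε ε' : ℤ) (x : ℚ × ℚ × ℚ) :
    symSerre (s ^ 2) ((PhiPart s hn c κ (-1)).mode s) ((XMinusPart s 0 (by omega) ε).mode s)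
      ((XMinusPart s 0 (by omega) ε').mode s) x = 0 :=
  symSerre_mode_eq_zero' s (pow_ne_zero 2 hs0) (PhiPart_XMinusPart_exchange hs0 hs hn c κ ε)
    (PhiPart_XMinusPart_exchange hs0 hs hn c κ ε') (XMinusPart_exchange hs0 hs hn ε ε')
    (contraction_XMinusPart_neg_one hs0 hs hn c κ ε)
    (contraction_XMinusPart_neg_one hs0 hs hn c κ ε')
    (zeroModeLocal_XMinusPart_PhiPart s hn c κ (-1) ε).expo_eq
    (zeroModeLocal_XMinusPart_PhiPart s hn c κ (-1) ε').expo_eq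
    (zeroModeLocal_XMinusPart hs0 hn ε ε').expo_eq
    (zeroModeLocal_XMinusPart hs0 hn ε' ε).expo_eq x

/-- The Serre relation is quadratic in the current, so that it follows from its polarization. -/
theorem serre_sub_of_symSerre [CharZero K] {R : Type*} [Ring R] [Algebra K R] {a : K}
    {Φ X Y : ℚ → R} {r t : ℚ} (hX : symSerre a Φ X X (r, t, t) = 0)
    (hY : symSerre a Φ Y Y (r, t, t) = 0) (hXY : symSerre a Φ X Y (r, t, t) = 0) :
    Φ r * (X t - Y t) ^ 2 - (a + a⁻¹) • ((X t - Y t) * Φ r * (X t - Y t)) +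
      (X t - Y t) ^ 2 * Φ r = 0 := by
  simp only [symSerre, serre] at hX hY hXY
  simp only [pow_two, mul_sub, sub_mul, ← mul_assoc]
  -- With two equal currents the symmetrized expression counts the Serre expression twice, hence the
  -- halves.
  linear_combination (norm := module) (2⁻¹ : K) • hX + (2⁻¹ : K) • hY - (1 : K) • hXY

theorem serre_smul_sub {R : Type*} [Ring R] [Algebra K R] {a : K} {P P' D : R}
    (h : P * D ^ 2 - a • (D * P * D) + D ^ 2 * P = 0)
    (h' : P' * D ^ 2 - a • (D * P' * D) + D ^ 2 * P' = 0) (θ η : K) :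
    (θ • (P - P')) * (η • D) ^ 2 - a • ((η • D) * (θ • (P - P')) * (η • D)) +
      (η • D) ^ 2 * (θ • (P - P')) = 0 := by
  simp only [smul_pow, smul_mul_assoc, mul_smul_comm, sub_mul, mul_sub]
  linear_combination (norm := module) (θ * η ^ 2) • h - (θ * η ^ 2) • h'

end SpBoson

end


theorem mainTheorem4 {K : Type*} [Field K] [CharZero K] (s : K) (hs0 : s ≠ 0)
    (hs : ∀ m : ℕ, 0 < m → s ^ m ≠ 1) (n : ℕ) (hn : 2 ≤ n) (c : K) (κ r : ℚ) :
    SpBoson.PhiBar s hn c κ r * SpBoson.f₁ s hn ^ 2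
      - (s ^ 2 + s ^ (-2 : ℤ)) •
          (SpBoson.f₁ s hn * SpBoson.PhiBar s hn c κ r * SpBoson.f₁ s hn)
      + SpBoson.f₁ s hn ^ 2 * SpBoson.PhiBar s hn c κ r = 0 := by
  have ha : s ^ (-2 : ℤ) = (s ^ 2)⁻¹ := by rw [zpow_neg]; norm_cast
  -- The index `r + 1` and the index 0, in place of r and −1, account for the factors 1/z in the two
  -- q-derivatives.
  have h₁ := SpBoson.serre_sub_of_symSerre (t := -((0 : ℤ) : ℚ))
    (SpBoson.symSerre_PhiPart_one hs0 hs hn c κ 1 1 (r + 1, _, _))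
    (SpBoson.symSerre_PhiPart_one hs0 hs hn c κ (-1) (-1) (r + 1, _, _))
    (SpBoson.symSerre_PhiPart_one hs0 hs hn c κ 1 (-1) (r + 1, _, _))
  have h₂ := SpBoson.serre_sub_of_symSerre (t := -((0 : ℤ) : ℚ))
    (SpBoson.symSerre_PhiPart_neg_one hs0 hs hn c κ 1 1 (r + 1, _, _))
    (SpBoson.symSerre_PhiPart_neg_one hs0 hs hn c κ (-1) (-1) (r + 1, _, _))
    (SpBoson.symSerre_PhiPart_neg_one hs0 hs hn c κ 1 (-1) (r + 1, _, _))
  rw [← ha] at h₁ h₂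
  exact SpBoson.serre_smul_sub h₁ h₂ _ _
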